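/- **Setting.** Let $k\ge 1$. A graph is $(k+1)$-claw-free if no vertex is adjacent to $k+1$ pairwise non-adjacent vertices. Given a $(k+1)$-claw-free graph $G=(V,E)$ with weights $w_v\ge 0$, one looks for an independent set of maximum weight. In weighted $k$-set packing one is given weighted sets with at most $k$ elements each and looks for pairwise disjoint sets of maximum total weight; this is the independent set problem in the conflict graph, whose vertices are the sets and whose edges join intersecting sets. Let $w(A)=\sum_{v\in A}w_v$ and $w^2(A)=\sum_{v\in A}w_v^2$, and let $N(C,S)$ be the set of vertices of $S$ that are adjacent or equal to a vertex of $C$. **Squared-weight local search with $s$-exchanges.** Start with the output $S$ of the greedy algorithm (repeatedly add a heaviest vertex that is neither in $S$ nor adjacent to $S$). As long as there is an independent set $C\subseteq V\setminus S$ with $|C|\le sk$ and $w^2(C)>w^2(N(C,S))$, replace $S$ by $(S\cup C)\setminus N(C,S)$. When there is no such $C$, return $S$. **Theorem.** For $k\ge1$ let $$\tau'_k=\max_{\epsilon\in[0,1/2]}\min\left\{\frac{1-\epsilon}{2-\epsilon},\ \Big(k-\frac1{\sqrt{1-\epsilon}}\Big)\big(1-\sqrt{1-\epsilon}\big)\right\},$$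 $$\tau_k=\max_{\epsilon\in[0,1/2]}\min\left\{\frac{2(1-\epsilon)}{3-\epsilon},\ \Big(k-\frac1{\sqrt{1-\epsilon}}\Big)\big(1-\sqrt{1-\epsilon}\big),\ 2-\frac1{\sqrt{1-\epsilon}}\right\}.$$ Let either $s=k(k-1)+1$ and $\alpha=\frac{k+1-\tau'_k}{2}$, or $s=2k(k-1)+1$ and $\alpha=\frac{k+1-\tau_k}{2}$. 1. For every finite $(k+1)$-claw-free graph with nonnegative real weights, and for every choice of ties and of improvements, squared-weight local search with $s$-exchanges terminates, and it returns an independent set $A$ with $w(O)\le\alpha\,w(A)$ for every independent set $O$. The same holds for weighted $k$-set packing, with packings in place of independent sets. 2. With rescaling of the weights and partial enumeration, the algorithm runs in polynomial time with the same factor: consider the algorithm that, for every vertex $v$ of an $n$-vertex graph with nonnegative rational weights, deletes $v$ and its neighbours, computes a greedy solution $S_0$ of the remaining instance, runs squared-weight local search with $s$-exchanges from $S_0$ for the weights $\lfloor 6n^2w_u/w(S_0)\rfloor$ (taken as $0$ if $w(S_0)=0$), adds $v$ to the result, and finally returns the heaviest of these solutions. For each fixed $k$, its number of bit operations is bounded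 by a polynomial in the size of the input, for $(k+1)$-claw-free graphs as well as for weighted $k$-set packing, and it returns a feasible solution $A$ with $w(O)\le\alpha\,w(A)$ for every feasible solution $O$. 3. $\tau'_k$ and $\tau_k$ are non-decreasing in $k$, with $\lim_{k\to\infty}\tau'_k=\frac12$ and $\lim_{k\to\infty}\tau_k=\frac23$. For $k=3$ the factors $\alpha$, rounded up to three decimals, are $1.811$ and $1.786$. -/

import Mathlib

open scoped NNRat

namespace SquaredWeight

/-! ## Graphs, claws, set packing -/

/-- `G` has no `d`-claw: no vertex (center) is adjacent to all members of a set of `d` pairwise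
non-adjacent vertices (talons). -/
def IsClawFree {V : Type*} (G : SimpleGraph V) (d : ℕ) : Prop :=
  ¬ ∃ (c : V) (T : Finset V), T.card = d ∧ (∀ t ∈ T, G.Adj c t) ∧ G.IsIndepSet (T : Set V)

/-- The conflict graph of an indexed family of sets: distinct members are adjacent when they
intersect. -/
def conflictGraph {ι U : Type*} (F : ι → Finset U) : SimpleGraph ι where
  Adj i j := i ≠ j ∧ ¬ Disjoint (F i) (F j)
  symm := ⟨fun _ _ h => ⟨h.1.symm, fun hd => h.2 hd.symm⟩⟩
  loopless := ⟨fun _ h => h.1 rfl⟩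

/-- A subfamily is a packing when its members are pairwise disjoint. -/
def IsPacking {ι U : Type*} (F : ι → Finset U) (P : Finset ι) : Prop :=
  (P : Set ι).PairwiseDisjoint F

/-! ## Squared-weight local search, with arbitrary choices, for real weights -/

open Classical in
/-- `N(C, A)`: the members of `A` that are adjacent to, or equal to, a member of `C`. -/
noncomputable def nbhd {V : Type*} (G : SimpleGraph V) (C A : Finset V) : Finset V :=
  A.filter fun b => (∃ a ∈ C, G.Adj a b) ∨ b ∈ C

/-- `v` can be added to `S`. -/
def IsFree {V : Type*} (G : SimpleGraph V) (S : Finset V) (v : V) : Prop :=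
  v ∉ S ∧ ∀ u ∈ S, ¬ G.Adj u v

/-- One step of the standard greedy algorithm: add a heaviest free vertex. -/
def GreedyStep {V : Type*} [DecidableEq V] (G : SimpleGraph V) (w : V → ℝ)
    (S T : Finset V) : Prop :=
  ∃ v, IsFree G S v ∧ (∀ u, IsFree G S u → w u ≤ w v) ∧ T = insert v S

/-- `S` is an output of the standard greedy algorithm (under some tie-breaking). -/
def IsGreedyOutput {V : Type*} [DecidableEq V] (G : SimpleGraph V) (w : V → ℝ)
    (S : Finset V) : Prop :=
  Relation.ReflTransGen (GreedyStep G w) ∅ S ∧ ∀ v, ¬ IsFree G S v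

/-- One improvement of the local search: exchange `N(C, S)` for an independent set `C` of at most
`r` vertices outside `S` with `w²(C) > w²(N(C, S))`. -/
def Improvement {V : Type*} [DecidableEq V] (G : SimpleGraph V) (w : V → ℝ) (r : ℕ)
    (S T : Finset V) : Prop :=
  ∃ C : Finset V, Disjoint C S ∧ C.card ≤ r ∧ G.IsIndepSet (C : Set V) ∧
    ∑ v ∈ nbhd G C S, w v ^ 2 < ∑ v ∈ C, w v ^ 2 ∧ T = (S ∪ C) \ nbhd G C S

/-- `A` is an output of squared-weight local search with exchanges that add at most `r` vertices:
start from an output of the greedy algorithm, make improvements until there is none. -/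
def IsLocalSearchOutput {V : Type*} [DecidableEq V] (G : SimpleGraph V) (w : V → ℝ) (r : ℕ)
    (A : Finset V) : Prop :=
  ∃ S₀, IsGreedyOutput G w S₀ ∧ Relation.ReflTransGen (Improvement G w r) S₀ A ∧
    ∀ T, ¬ Improvement G w r A T

/-! ## The constants -/

/-- `min {(1-ε)/(2-ε), (k - 1/√(1-ε)) (1 - √(1-ε))}` -/
noncomputable def gainTwo (k : ℕ) (ε : ℝ) : ℝ :=
  min ((1 - ε) / (2 - ε)) ((k - 1 / √(1 - ε)) * (1 - √(1 - ε)))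

/-- `min {2(1-ε)/(3-ε), (k - 1/√(1-ε)) (1 - √(1-ε)), 2 - 1/√(1-ε)}` -/
noncomputable def gainThree (k : ℕ) (ε : ℝ) : ℝ :=
  min (2 * (1 - ε) / (3 - ε))
    (min ((k - 1 / √(1 - ε)) * (1 - √(1 - ε))) (2 - 1 / √(1 - ε)))

/-- `τ_k` for `s = k(k-1)+1`, the maximum of `gainTwo k` on `[0, 1/2]`. -/
noncomputable def tauTwo (k : ℕ) : ℝ := sSup (gainTwo k '' Set.Icc 0 (1 / 2))

/-- `τ_k` for `s = 2k(k-1)+1`, the maximum of `gainThree k` on `[0, 1/2]`. -/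
noncomputable def tauThree (k : ℕ) : ℝ := sSup (gainThree k '' Set.Icc 0 (1 / 2))

/-! ## A step-counting model of computation

Programs are written in a monad that counts bit operations. As on a random access machine with
logarithmic cost, every arithmetic operation is charged according to the number of binary digits of
its operands, and every access to a table according to the length of the address and of the entry.
Every pass through a loop is charged at least one step. -/

/-- A computation that either has not halted (`none`), or has halted with a result and the number
of steps made. -/
def Timed (α : Type) : Type := Option (α × ℕ)

namespace Timed

instance : Monad Timed where
  pure a := some (a, 0)
  bind x f := match x with
    | none => none
    | some (a, t) => match f a with
      | none => none
      | some (b, t') => some (b, t + t')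

/-- The computation `x` halts with result `a` after `t` steps. -/
def HaltsWith {α : Type} (x : Timed α) (a : α) (t : ℕ) : Prop := x = some (a, t)

/-- A computation that has not halted. -/
def running {α : Type} : Timed α := none

/-- Spend `c` steps. -/
def tick (c : ℕ) : Timed Unit := some ((), c)

end Timed

open Timed

/-- Addition of binary numbers. -/
def addN (a b : ℕ) : Timed ℕ := do
  tick (1 + a.size + b.size)
  pure (a + b)

/-- Multiplication of binary numbers. -/
def mulN (a b : ℕ) : Timed ℕ := do
  tick ((1 + a.size) * (1 + b.size))
  pure (a * b)

/-- Rounded-down division of binary numbers (with value `0` for the divisor `0`). -/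
def divN (a b : ℕ) : Timed ℕ := do
  tick ((1 + a.size) * (1 + b.size))
  pure (a / b)

/-- Is `a < b`? -/
def ltN (a b : ℕ) : Timed Bool := do
  tick (1 + a.size + b.size)
  pure (decide (a < b))

/-- Is it the same vertex? -/
def sameVertex {n : ℕ} (u v : Fin n) : Timed Bool := do
  tick (1 + n.size)
  pure (decide (u = v))

/-- Read an entry of a table of bits. -/
def readBit {n : ℕ} (S : Fin n → Bool) (v : Fin n) : Timed Bool := do
  tick (1 + n.size)
  pure (S v)

/-- Read an entry of a table of numbers. -/
def readN {n : ℕ} (w : Fin n → ℕ) (v : Fin n) : Timed ℕ := do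
  tick (1 + n.size + (w v).size)
  pure (w v)

/-- Compute and store a table with `n` entries. -/
def tabulate {α : Type} : {n : ℕ} → (Fin n → Timed α) → Timed (Fin n → α)
  | 0, _ => pure Fin.elim0
  | n + 1, f => do
    tick (1 + (n + 1).size)
    let a ← f 0
    let T ← tabulate fun i => f i.succ
    pure (Fin.cons a T)

/-- The sublist of the entries that pass a test. -/
def filterC {α : Type} (test : α → Timed Bool) : List α → Timed (List α)
  | [] => pure []
  | a :: l => do
    tick 1
    let b ← test a
    let r ← filterC test l
    pure (if b then a :: r else r)

/-! ## Squared-weight local search as a program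

The graph is accessed through a program `adj` that decides adjacency of two vertices; vertex sets are
tables of bits; `alive` marks the vertices of the induced subgraph that is worked on. -/

/-- Is `u` a member of the list `C`, or adjacent to one? -/
def conflicts {n : ℕ} (adj : Fin n → Fin n → Timed Bool) (u : Fin n) (C : List (Fin n)) :
    Timed Bool :=
  C.anyM fun c => do
    if ← sameVertex u c then pure true else adj u c

/-- Are the members of the list `C` distinct and pairwise non-adjacent? -/
def independentC {n : ℕ} (adj : Fin n → Fin n → Timed Bool) : List (Fin n) → Timed Bool
  | [] => do
    tick 1
    pure true
  | c :: C => do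
    tick 1
    if ← conflicts adj c C then pure false else independentC adj C

/-- The sum of the squared weights over a list. -/
def sqWeight {n : ℕ} (w : Fin n → ℕ) (C : List (Fin n)) : Timed ℕ :=
  C.foldlM (fun acc v => do
    let x ← readN w v
    let y ← mulN x x
    addN acc y) 0

/-- The total weight of a set. -/
def weightC {n : ℕ} (w : Fin n → ℕ) (S : Fin n → Bool) : Timed ℕ :=
  (List.finRange n).foldlM (fun acc v => do
    if ← readBit S v then
      let x ← readN w v
      addN acc x
    else pure acc) 0

/-- Is `C` an independent set of live vertices outside `S` with `w²(C) > w²(N(C, S))`? -/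
def isImprovement {n : ℕ} (adj : Fin n → Fin n → Timed Bool) (alive : Fin n → Bool)
    (w : Fin n → ℕ) (S : Fin n → Bool) (C : List (Fin n)) : Timed Bool := do
  let outside ← C.allM fun c => do
    let a ← readBit alive c
    let b ← readBit S c
    pure (a && !b)
  let indep ← independentC adj C
  if outside && indep then
    let N ← filterC (fun u => do
      if ← readBit S u then conflicts adj u C else pure false) (List.finRange n)
    let x ← sqWeight w N
    let y ← sqWeight w C
    ltN x y
  else pure false

/-- Enumerate all ways to extend the list `C` by at most `r` vertices until an improvement is
found. -/
def findImprovement {n : ℕ} (adj : Fin n → Fin n → Timed Bool) (alive : Fin n → Bool)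
    (w : Fin n → ℕ) (S : Fin n → Bool) : ℕ → List (Fin n) → Timed (Option (List (Fin n)))
  | 0, C => do
    if ← isImprovement adj alive w S C then pure (some C) else pure none
  | r + 1, C => do
    if ← isImprovement adj alive w S C then pure (some C)
    else (List.finRange n).findSomeM? fun v => findImprovement adj alive w S r (v :: C)

/-- `S ∪ C \ N(C, S)`, for a list `C` of vertices outside `S`. -/
def exchange {n : ℕ} (adj : Fin n → Fin n → Timed Bool) (S : Fin n → Bool) (C : List (Fin n)) :
    Timed (Fin n → Bool) :=
  tabulate fun u => do
    if ← C.anyM (fun c => sameVertex u c) then pure true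
    else if ← readBit S u then
      let b ← conflicts adj u C
      pure (!b)
    else pure false

/-- Squared-weight local search from `S`, with exchanges that add at most `r` vertices. There is no
bound on the number of improvements in the algorithm: the computation is `running` as long as more
than `fuel` rounds are needed, and once it halts, neither its result nor its number of steps depends
on `fuel`. -/
def localSearch {n : ℕ} (adj : Fin n → Fin n → Timed Bool) (alive : Fin n → Bool)
    (w : Fin n → ℕ) (r : ℕ) : ℕ → (Fin n → Bool) → Timed (Fin n → Bool)
  | 0, _ => running
  | fuel + 1, S => do
    tick 1
    match ← findImprovement adj alive w S r [] with
    | none => pure S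
    | some C =>
      let S' ← exchange adj S C
      localSearch adj alive w r fuel S'

/-- A heaviest live vertex that is neither in `S` nor adjacent to a member of `S`, if there is
one. -/
def heaviestFree {n : ℕ} (adj : Fin n → Fin n → Timed Bool) (alive : Fin n → Bool)
    (w : Fin n → ℕ) (S : Fin n → Bool) : Timed (Option (Fin n)) := do
  let members ← filterC (fun u => readBit S u) (List.finRange n)
  (List.finRange n).foldlM (fun best v => do
    let a ← readBit alive v
    let c ← conflicts adj v members
    if a && !c then
      match best with
      | none => pure (some v)
      | some b =>
        let x ← readN w b
        let y ← readN w v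
        if ← ltN x y then pure (some v) else pure (some b)
    else pure best) none

/-- At most `m` steps of the standard greedy algorithm from `S`. -/
def greedyFrom {n : ℕ} (adj : Fin n → Fin n → Timed Bool) (alive : Fin n → Bool)
    (w : Fin n → ℕ) : ℕ → (Fin n → Bool) → Timed (Fin n → Bool)
  | 0, S => pure S
  | m + 1, S => do
    tick 1
    match ← heaviestFree adj alive w S with
    | none => pure S
    | some v =>
      let S' ← tabulate fun u => do
        if ← sameVertex u v then pure true else readBit S u
      greedyFrom adj alive w m S'

/-- The empty vertex set. -/
def emptyC (n : ℕ) : Timed (Fin n → Bool) := tabulate fun _ => pure false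

/-- Local search with rescaled weights on the live vertices: from the greedy solution `S₀` for `w`,
run the local search for the weights `⌊d w_v⌋`, where `d = n / (ε w(S₀))` and `ε = 1 / (6n)`. -/
def scaledLocalSearch {n : ℕ} (adj : Fin n → Fin n → Timed Bool) (alive : Fin n → Bool)
    (w : Fin n → ℕ) (r fuel : ℕ) : Timed (Fin n → Bool) := do
  let E ← emptyC n
  let S₀ ← greedyFrom adj alive w n E
  let W ← weightC w S₀
  let c ← mulN n n
  let d ← mulN 6 c
  let w' ← tabulate fun v => do
    let x ← readN w v
    let y ← mulN d x
    divN y W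
  localSearch adj alive w' r fuel S₀

/-- Partial enumeration: for every vertex `v`, solve the residual instance in which `v` and its
neighbours are deleted, and add `v` to the solution; return the best of these solutions. -/
def approxInt {n : ℕ} (adj : Fin n → Fin n → Timed Bool) (w : Fin n → ℕ) (r fuel : ℕ) :
    Timed (Fin n → Bool) := do
  let E ← emptyC n
  (List.finRange n).foldlM (fun best v => do
    let alive ← tabulate fun u => do
      let b ← conflicts adj u [v]
      pure (!b)
    let A' ← scaledLocalSearch adj alive w r fuel
    let A ← tabulate fun u => do
      if ← sameVertex u v then pure true else readBit A' u
    let x ← weightC w best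
    let y ← weightC w A
    if ← ltN x y then pure A else pure best) E

/-- Multiply rational weights, given by numerators and denominators, by the product of all
denominators. -/
def clearDenominators {n : ℕ} (w : Fin n → ℚ≥0) : Timed (Fin n → ℕ) := do
  let D ← (List.finRange n).foldlM (fun acc v => do
    let q ← readN (fun u => (w u).den) v
    mulN acc q) 1
  tabulate fun v => do
    let p ← readN (fun u => (w u).num) v
    let q ← readN (fun u => (w u).den) v
    let m ← divN D q
    mulN p m

/-- The approximation algorithm for rational weights: squared-weight local search with exchanges
that add at most `r` vertices, with rescaled weights and partial enumeration. -/
def approx {n : ℕ} (adj : Fin n → Fin n → Timed Bool) (w : Fin n → ℚ≥0) (r fuel : ℕ) :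
    Timed (Fin n → Bool) := do
  let w' ← clearDenominators w
  approxInt adj w' r fuel

/-- Read an entry of the adjacency matrix of a graph. -/
def adjMatrixQuery {n : ℕ} (G : SimpleGraph (Fin n)) [DecidableRel G.Adj] (u v : Fin n) :
    Timed Bool := do
  tick (1 + 2 * n.size)
  pure (decide (G.Adj u v))

/-- Adjacency in the conflict graph of a family of finite sets, each given as a list of its
elements, by comparing all pairs of elements. -/
def conflictQuery {n : ℕ} (F : Fin n → Finset ℕ) (i j : Fin n) : Timed Bool := do
  if ← sameVertex i j then pure false
  else
    tick (1 + 2 * n.size)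
    ((F i).sort).anyM fun x => do
      tick 1
      ((F j).sort).anyM fun y => do
        tick (1 + x.size + y.size)
        pure (decide (x = y))

/-- The number of binary digits of a list of nonnegative rational numbers. -/
def weightSize {n : ℕ} (w : Fin n → ℚ≥0) : ℕ := ∑ v, ((w v).num.size + (w v).den.size)

/-- The size of a weighted graph, given by its adjacency matrix and its weights. -/
def graphInputSize {n : ℕ} (w : Fin n → ℚ≥0) : ℕ := n * n + weightSize w

/-- The size of a weighted family of finite sets, given by lists of elements and the weights. -/
def familyInputSize {n : ℕ} (F : Fin n → Finset ℕ) (w : Fin n → ℚ≥0) : ℕ :=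
  n + ∑ i, ∑ x ∈ F i, (1 + x.size) + weightSize w

/-- The vertex set stored in a table of bits. -/
def toSet {n : ℕ} (S : Fin n → Bool) : Finset (Fin n) := Finset.univ.filter fun v => S v = true

end SquaredWeight

namespace SquaredWeight

/-! ## Exchanges of blocks -/

/-! Let `A` be a local optimum, `O` an independent set whose members have positive weight, `N o` the
members of `A` adjacent or equal to `o`, and `π o` the heaviest member of `N o`. Claw-freeness
bounds `|N o|`, and the number of `o` with a given `a` in `N o`, by `k`. Local optimality is applied
to the sets of all `o` with `π o` in a block `B ⊆ A` and `w (π o)` below a threshold. Squares are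
linearized by `u² ≥ 2λuw - λ²w²`, and Abel summation over the thresholds turns the inequalities
between squared weights into one between weights (`block_bound`). Members of `N o` outside the block
cost only a credit `c b * w b`.

Put `x = √(1 - ε)`. Join `π o` to the other members of `N o` that are heavier than `x² w(π o)`.
Degrees in this graph on `A` are at most `k(k-1)`, and adjacent weights differ by a factor of at
most `1/x²`. A component with at most `q` vertices is exchanged as a whole: all outside neighbours
are light, so `λ = x` and credit `x` are affordable, which gains `(k - 1/x)(1 - x)` per unit of
weight of `A`. In a larger component the credit is `1`, but a block contains pairs `π o, b` with
both ends inside it, and `b` is not charged as an outside neighbour. A spanning tree is cut into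
pieces with at least `q + 1` and at most `q k(k-1) + 1` vertices (`sum_nonpos_of_rooted`), which is
the exchange size `s`. The tree edges of a piece save at least `x²/(1+x²)` of its weight for `q = 1`
and `2x²/(2+x²)` for `q = 2`. Summing over blocks and counting the pairs `(o, b)` with `b ∈ N o`
twice yields the factor (`ratio_of_exchange_stable`).

For polynomial time, the rescaled weights are integers of size at most `6n²`, so the squared weight
of the solution can increase only polynomially often. Guessing the heaviest vertex `v` of an optimum
pays for rounding: the loss is at most `w v / 6`, while `α ≥ 7/6` for `k ≥ 2`. For `k = 1` the
greedy solution is already a local optimum (`ratio_of_beatsCandidate`). The rest is a verification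
of the programs with Hoare triples that bound the number of steps. -/

theorem sum_nonpos_of_sum_lower_nonpos {α : Type*} (w y : α → ℝ) (B : Finset α)
    (hw : ∀ a ∈ B, 0 ≤ w a) (h0 : ∀ a ∈ B, w a = 0 → y a ≤ 0)
    (h : ∀ t, ∑ a ∈ B with w a < t, w a * y a ≤ 0) : ∑ a ∈ B, y a ≤ 0 := by
  classical
  -- Abel summation, as an induction that removes the heaviest level. The bound `t` is kept free so
  -- that the lighter elements can be compared with the weight of the level above them.
  suffices H : ∀ t, 0 < t → (∀ a ∈ B, w a ≤ t) → t * ∑ a ∈ B, y a ≤ ∑ a ∈ B, w a * y a by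
    obtain ⟨t, ht⟩ : ∃ t, ∀ a ∈ B, w a ≤ t := ⟨∑ a ∈ B, w a, fun a ha =>
      Finset.single_le_sum hw ha⟩
    have h1 := H (max t 0 + 1) (by positivity) fun a ha =>
      (ht a ha).trans (by linarith [le_max_left t 0])
    have h2 := h (max t 0 + 1)
    rw [Finset.filter_true_of_mem fun a ha =>
      (ht a ha).trans_lt (by linarith [le_max_left t 0])] at h2
    have : 0 < max t 0 + 1 := by positivity
    by_contra hc
    push Not at hc
    nlinarith [mul_pos this hc]
  induction B using Finset.strongInduction with
  | H B ih =>
    intro t ht hB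
    rcases B.eq_empty_or_nonempty with rfl | hne
    · simp
    obtain ⟨m, hm, hmax⟩ := B.exists_max_image w hne
    have hall : ∑ a ∈ B, w a * y a ≤ 0 := by
      have h2 := h (w m + 1)
      rwa [Finset.filter_true_of_mem fun a ha =>
        (hmax a ha).trans_lt (by linarith)] at h2
    rcases (hw m hm).eq_or_lt with hM | hM
    · have hz : ∀ a ∈ B, w a = 0 := fun a ha => le_antisymm (hM ▸ hmax a ha) (hw a ha)
      rw [Finset.sum_eq_zero (f := fun a => w a * y a) fun a ha => by rw [hz a ha, zero_mul]]
      exact mul_nonpos_of_nonneg_of_nonpos ht.le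
        (Finset.sum_nonpos fun a ha => h0 a ha (hz a ha))
    -- Lighter elements satisfy this by induction with `t = w m`; on the heaviest level it is an
    -- equality.
    have key : w m * ∑ a ∈ B, y a ≤ ∑ a ∈ B, w a * y a := by
      have hsub : B.filter (fun a => w a < w m) ⊂ B :=
        Finset.filter_ssubset.2 ⟨m, hm, lt_irrefl _⟩
      have h1 := ih _ hsub (fun a ha => hw a (hsub.1 ha)) (fun a ha => h0 a (hsub.1 ha))
        (fun t => by
          have := h (min t (w m))
          rw [Finset.filter_filter]
          convert this using 2
          ext a
          simp [and_comm]) (w m) hM (fun a ha => (Finset.mem_filter.1 ha).2.le)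
      have h2 : w m * ∑ a ∈ B with ¬ w a < w m, y a = ∑ a ∈ B with ¬ w a < w m, w a * y a := by
        rw [Finset.mul_sum]
        refine Finset.sum_congr rfl fun a ha => ?_
        obtain ⟨h3, h4⟩ := Finset.mem_filter.1 ha
        rw [le_antisymm (hmax a h3) (not_lt.1 h4)]
      rw [← Finset.sum_filter_add_sum_filter_not B (fun a => w a < w m) y,
        ← Finset.sum_filter_add_sum_filter_not B (fun a => w a < w m) (fun a => w a * y a),
        mul_add, h2]
      exact add_le_add_left h1 _
    have hY : ∑ a ∈ B, y a ≤ 0 := by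
      by_contra hc
      push Not at hc
      nlinarith [mul_pos hM hc]
    nlinarith [hB m hm]

/-- The passage from squared weights to weights. Each `o` is worth `λ w(π o)` times the summand on
the left in terms of squared weights; dividing by the weight of `π o` is legitimate because the
exchange inequality holds for the `o` below every threshold, not only for the whole block. -/
theorem block_bound {α β : Type*} [Fintype β] [DecidableEq α] [DecidableEq β]
    (N : β → Finset α) (w c : α → ℝ) (u : β → ℝ) (π : β → α) (r : ℕ) (lam : ℝ)
    (hw : ∀ a, 0 ≤ w a) (hmax : ∀ o, ∀ b ∈ N o, w b ≤ w (π o)) (hpos : ∀ o, 0 < w (π o))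
    (hlo : ∀ C : Finset β, C.card ≤ r → ∑ o ∈ C, u o ^ 2 ≤ ∑ b ∈ C.biUnion N, w b ^ 2)
    (B : Finset α) (hB : (Finset.univ.filter fun o => π o ∈ B).card ≤ r)
    (hc : ∀ o, π o ∈ B → ∀ b ∈ N o \ B, w b ≤ lam * c b * w (π o)) :
    lam * ∑ o with π o ∈ B, (2 * u o - lam * w (π o) - ∑ b ∈ N o \ B, c b * w b)
      ≤ ∑ b ∈ B, w b := by
  set g : β → ℝ := fun o => 2 * u o - lam * w (π o) - ∑ b ∈ N o \ B, c b * w b with hg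
  have key := sum_nonpos_of_sum_lower_nonpos w (fun a => lam * ∑ o with π o = a, g o - w a) B
    (fun a _ => hw a) (fun a _ h0 => by
      rw [Finset.sum_eq_zero, h0]; · simp
      intro o ho
      have := hpos o
      rw [(Finset.mem_filter.1 ho).2, h0] at this
      exact absurd this (lt_irrefl _)) ?_
  · rw [Finset.sum_sub_distrib, ← Finset.mul_sum, Finset.sum_fiberwise_eq_sum_filter] at key
    linarith
  intro t
  set B' := B.filter (fun a => w a < t) with hB'
  set C : Finset β := Finset.univ.filter fun o => π o ∈ B' with hC
  have h1 := hlo C ((Finset.card_le_card fun o ho => by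
    simp only [hC, hB', Finset.mem_filter, Finset.mem_univ, true_and] at ho ⊢
    exact ho.1).trans hB)
  have hCm : ∀ o ∈ C, π o ∈ B ∧ w (π o) < t := fun o ho => by
    simpa [hC, hB'] using ho
  have h2 : ∑ b ∈ C.biUnion N, w b ^ 2 ≤ ∑ b ∈ B', w b ^ 2 + ∑ o ∈ C, ∑ b ∈ N o \ B, w b ^ 2 := by
    -- No member of `N o` is heavier than `π o`, so those inside the block stay below the threshold.
    have hsub : C.biUnion N ⊆ B' ∪ C.biUnion fun o => N o \ B := by
      intro b hb
      obtain ⟨o, ho, hbo⟩ := Finset.mem_biUnion.1 hb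
      by_cases hbB : b ∈ B
      · exact Finset.mem_union_left _ (Finset.mem_filter.2
          ⟨hbB, (hmax o b hbo).trans_lt (hCm o ho).2⟩)
      · exact Finset.mem_union_right _ (Finset.mem_biUnion.2
          ⟨o, ho, Finset.mem_sdiff.2 ⟨hbo, hbB⟩⟩)
    calc _ ≤ ∑ b ∈ B' ∪ C.biUnion fun o => N o \ B, w b ^ 2 :=
          Finset.sum_le_sum_of_subset_of_nonneg hsub fun _ _ _ => sq_nonneg _
      _ ≤ ∑ b ∈ B', w b ^ 2 + ∑ b ∈ C.biUnion fun o => N o \ B, w b ^ 2 := by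
          rw [← Finset.sum_union_inter]
          exact le_add_of_nonneg_right (Finset.sum_nonneg fun _ _ => sq_nonneg _)
      _ ≤ _ := by
          gcongr
          clear h1 hCm hsub
          induction C using Finset.induction_on with
          | empty => simp
          | insert o C ho ih =>
            rw [Finset.biUnion_insert, Finset.sum_insert ho]
            refine le_trans ?_ (add_le_add_right ih _)
            rw [← Finset.sum_union_inter]
            exact le_add_of_nonneg_right (Finset.sum_nonneg fun _ _ => sq_nonneg _)
  -- The square `(u o - λ w(π o))² ≥ 0` linearizes `u o ^ 2`, and `hc` bounds each outside `w b ^ 2`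
  -- by `λ w(π o) c b w b`.
  have h3 : ∀ o ∈ C, lam * (w (π o) * g o) ≤ u o ^ 2 - ∑ b ∈ N o \ B, w b ^ 2 := by
    intro o ho
    have h4 : ∑ b ∈ N o \ B, w b ^ 2 ≤ lam * w (π o) * ∑ b ∈ N o \ B, c b * w b := by
      rw [Finset.mul_sum]
      refine Finset.sum_le_sum fun b hb => ?_
      have := mul_le_mul_of_nonneg_right (hc o (hCm o ho).1 b hb) (hw b)
      nlinarith
    simp only [hg]
    nlinarith [sq_nonneg (u o - lam * w (π o))]
  have h4 := Finset.sum_le_sum h3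
  rw [Finset.sum_sub_distrib] at h4
  have h5 : ∑ a ∈ B', w a * (lam * ∑ o with π o = a, g o - w a)
      = ∑ o ∈ C, lam * (w (π o) * g o) - ∑ a ∈ B', w a ^ 2 := by
    simp only [mul_sub, Finset.sum_sub_distrib, ← sq]
    congr 1
    rw [hC, ← Finset.sum_fiberwise_eq_sum_filter]
    refine Finset.sum_congr rfl fun a _ => ?_
    rw [Finset.mul_sum, Finset.mul_sum]
    refine Finset.sum_congr rfl fun o ho => ?_
    rw [(Finset.mem_filter.1 ho).2]
    ring
  rw [h5]
  linarith

/-! ## Partitions of rooted trees -/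

/-- In `S`, following `par` from a vertex other than `r` leads to an adjacent vertex of `S` of
smaller rank. -/
structure IsRooted {α : Type*} (G : SimpleGraph α) (rk : α → ℕ) (par : α → α) (S : Finset α)
    (r : α) : Prop where
  mem : r ∈ S
  par_mem : ∀ v ∈ S, v ≠ r → par v ∈ S
  adj : ∀ v ∈ S, v ≠ r → G.Adj v (par v)
  rk_lt : ∀ v ∈ S, v ≠ r → rk (par v) < rk v

/-- A tree with more than `q D + 1` vertices is cut at a vertex of maximal rank whose subtree has
more than `q` vertices. That subtree is a piece of admissible size, and enough vertices remain to
continue with the rest. -/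
theorem sum_nonpos_of_rooted {α : Type*} [Fintype α] (G : SimpleGraph α)
    (rk : α → ℕ) (par : α → α) (q D : ℕ) (hD : ∀ v, {u | G.Adj v u}.ncard ≤ D) (f : α → ℝ)
    (S₀ : Finset α) (base : ∀ S ⊆ S₀, ∀ r, IsRooted G rk par S r → q + 1 ≤ S.card → S.card ≤ q * D + 1 →
      ∑ a ∈ S, f a ≤ 0) (S : Finset α) (hS₀ : S ⊆ S₀) (r : α) (hS : IsRooted G rk par S r)
    (hcard : q + 1 ≤ S.card) : ∑ a ∈ S, f a ≤ 0 := by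
  classical
  induction hn : S.card using Nat.strong_induction_on generalizing S with
  | _ n ih =>
  subst hn
  by_cases hsmall : S.card ≤ q * D + 1
  · exact base S hS₀ r hS hcard hsmall
  push Not at hsmall
  let step : α → α → Prop := fun a b => a ∈ S ∧ a ≠ r ∧ b = par a
  let T : α → Finset α := fun v => S.filter fun u => Relation.ReflTransGen step u v
  have hTr : T r = S := by
    refine Finset.filter_true_of_mem fun u hu => ?_
    induction hk : rk u using Nat.strong_induction_on generalizing u with
    | _ n ih =>
      subst hk
      by_cases hur : u = r
      · rw [hur]
      · exact Relation.ReflTransGen.head (b := par u) ⟨hu, hur, rfl⟩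
          (ih _ (hS.rk_lt u hu hur) _ (hS.par_mem u hu hur) rfl)
  -- `T v` is the subtree below `v`. Children have larger rank, so by the choice of `v` their
  -- subtrees have at most `q` vertices.
  obtain ⟨v, hv, hvmax⟩ := (S.filter fun v => q + 1 ≤ (T v).card).exists_max_image rk
    ⟨r, Finset.mem_filter.2 ⟨hS.mem, by rwa [hTr]⟩⟩
  obtain ⟨hvS, hvT⟩ := Finset.mem_filter.1 hv
  set ch : Finset α := S.filter fun c => c ≠ r ∧ par c = v with hch
  have hTsub : T v ⊆ {v} ∪ ch.biUnion T := by
    intro u hu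
    obtain ⟨huS, hu⟩ := Finset.mem_filter.1 hu
    rcases Relation.ReflTransGen.cases_tail hu with rfl | ⟨c, huc, hcS, hcr, hcv⟩
    · simp
    · refine Finset.mem_union_right _ (Finset.mem_biUnion.2 ⟨c, ?_, ?_⟩)
      · exact Finset.mem_filter.2 ⟨hcS, hcr, hcv.symm⟩
      · exact Finset.mem_filter.2 ⟨huS, huc⟩
  have hchT : ∀ c ∈ ch, (T c).card ≤ q := by
    intro c hc
    obtain ⟨hcS, hcr, hcv⟩ := Finset.mem_filter.1 hc
    by_contra hcon
    have := hvmax c (Finset.mem_filter.2 ⟨hcS, by omega⟩)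
    have h2 := hS.rk_lt c hcS hcr
    rw [hcv] at h2
    omega
  have hTcard : (T v).card ≤ 1 + ch.card * q := by
    calc (T v).card ≤ _ := Finset.card_le_card hTsub
      _ ≤ 1 + (ch.biUnion T).card := by
        simpa using Finset.card_union_le {v} (ch.biUnion T)
      _ ≤ _ := by gcongr; exact Finset.card_biUnion_le_card_mul _ _ _ hchT
  have hchadj : (ch : Set α) ⊆ {u | G.Adj v u} := by
    intro c hc
    obtain ⟨hcS, hcr, hcv⟩ := Finset.mem_filter.1 (Finset.mem_coe.1 hc)
    have := (hS.adj c hcS hcr).symm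
    rwa [hcv] at this
  by_cases hvr : v = r
  · have h1 : ch.card ≤ D := by
      rw [← Set.ncard_coe_finset]
      exact (Set.ncard_le_ncard hchadj).trans (hD v)
    rw [hvr, hTr] at hTcard
    have : ch.card * q ≤ D * q := Nat.mul_le_mul_right _ h1
    rw [mul_comm] at hsmall
    omega
  -- A vertex other than the root spends one of its `D` neighbours on its parent.
  have hchD : ch.card + 1 ≤ D := by
    have hnot : par v ∉ ch := fun h => by
      obtain ⟨h1, h2, h3⟩ := Finset.mem_filter.1 h
      have h4 := hS.rk_lt _ h1 h2
      have h5 := hS.rk_lt v hvS hvr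
      rw [h3] at h4
      omega
    rw [← Finset.card_insert_of_notMem hnot, ← Set.ncard_coe_finset]
    refine (Set.ncard_le_ncard ?_).trans (hD v)
    rw [Finset.coe_insert]
    exact Set.insert_subset (hS.adj v hvS hvr) hchadj
  have hTS : T v ⊆ S := Finset.filter_subset _ _
  -- Hence the subtree has at most `1 + q (D - 1)` of the at least `q D + 2` vertices, and `q + 1`
  -- remain.
  have hDq : ch.card * q + q ≤ q * D := by
    calc ch.card * q + q = q * (ch.card + 1) := by ring
      _ ≤ _ := Nat.mul_le_mul_left _ hchD
  have hTroot : IsRooted G rk par (T v) v := by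
    refine ⟨Finset.mem_filter.2 ⟨hvS, .refl⟩, fun u hu huv => ?_, fun u hu huv => ?_,
      fun u hu huv => ?_⟩ <;>
    · obtain ⟨huS, hu⟩ := Finset.mem_filter.1 hu
      rcases Relation.ReflTransGen.cases_head hu with rfl | ⟨c, ⟨_, hur, rfl⟩, hcv⟩
      · exact absurd rfl huv
      · first
          | exact Finset.mem_filter.2 ⟨hS.par_mem u huS hur, hcv⟩
          | exact hS.adj u huS hur
          | exact hS.rk_lt u huS hur
  have hrest : IsRooted G rk par (S \ T v) r := by
    refine ⟨Finset.mem_sdiff.2 ⟨hS.mem, fun h => ?_⟩, fun u hu hur => ?_,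
      fun u hu hur => hS.adj u (Finset.mem_sdiff.1 hu).1 hur,
      fun u hu hur => hS.rk_lt u (Finset.mem_sdiff.1 hu).1 hur⟩
    · rcases Relation.ReflTransGen.cases_head (Finset.mem_filter.1 h).2 with h | ⟨c, ⟨_, h, _⟩, _⟩
      · exact hvr h.symm
      · exact h rfl
    · obtain ⟨huS, hu⟩ := Finset.mem_sdiff.1 hu
      refine Finset.mem_sdiff.2 ⟨hS.par_mem u huS hur, fun h => hu ?_⟩
      exact Finset.mem_filter.2 ⟨huS, .head ⟨huS, hur, rfl⟩ (Finset.mem_filter.1 h).2⟩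
  have hcs := Finset.card_sdiff_add_card_eq_card hTS
  have h1 : ∑ a ∈ T v, f a ≤ 0 :=
    base _ (hTS.trans hS₀) v hTroot hvT (by omega)
  have h2 : ∑ a ∈ S \ T v, f a ≤ 0 :=
    ih (S \ T v).card (by omega) (S \ T v) (Finset.sdiff_subset.trans hS₀) hrest (by omega) rfl
  rw [← Finset.sum_sdiff hTS]
  linarith

/-- A shortest-path tree: the rank is the distance to an arbitrary root, the parent is the next
vertex on a shortest path. -/
theorem exists_rooted {α : Type*} [Fintype α] (G : SimpleGraph α)
    (K : G.ConnectedComponent) [DecidablePred fun v => G.connectedComponentMk v = K] :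
    ∃ rk par r, IsRooted G rk par (Finset.univ.filter fun v => G.connectedComponentMk v = K) r := by
  classical
  obtain ⟨r, hr⟩ := K.exists_rep
  have hr' : G.connectedComponentMk r = K := hr
  have h : ∀ v, G.connectedComponentMk v = K → v ≠ r → ∃ u, G.connectedComponentMk u = K ∧
      G.Adj v u ∧ G.dist r u < G.dist r v := by
    intro v hv hvr
    have hreach : G.Reachable v r := SimpleGraph.ConnectedComponent.exact (hv.trans hr'.symm)
    obtain ⟨p, hp⟩ := hreach.exists_walk_length_eq_dist
    cases p with
    | nil => exact absurd rfl hvr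
    | @cons _ u _ hadj p =>
      refine ⟨u, ?_, hadj, ?_⟩
      · rw [← hv]; exact SimpleGraph.ConnectedComponent.sound hadj.symm.reachable
      · rw [SimpleGraph.dist_comm, SimpleGraph.dist_comm (u := r) (v := v), ← hp]
        exact (SimpleGraph.dist_le p).trans_lt (by simp)
  choose! par hpar using h
  refine ⟨G.dist r, par, r, ⟨by simpa using hr', ?_, ?_, ?_⟩⟩ <;> intro v hv hvr <;>
    have := hpar v (by simpa using hv) hvr
  · simpa using this.1
  · exact this.2.1
  · exact this.2.2

/-- A vertex of smallest rank outside `R` has its parent in `R`. This supplies the edges that cover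
the root in the two estimates below. -/
theorem IsRooted.exists_child {α : Type*} [DecidableEq α] {G : SimpleGraph α} {rk : α → ℕ}
    {par : α → α} {S : Finset α} {r : α} (hS : IsRooted G rk par S r) (R : Finset α)
    (hr : r ∈ R) (hR : R.card < S.card) : ∃ v ∈ S, v ∉ R ∧ par v ∈ R := by
  obtain ⟨v, hv, hmin⟩ := (S \ R).exists_min_image rk
    (Finset.card_pos.1 (by have := Finset.le_card_sdiff R S; omega))
  obtain ⟨hvS, hvR⟩ := Finset.mem_sdiff.1 hv
  have hvr : v ≠ r := fun h => hvR (h ▸ hr)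
  refine ⟨v, hvS, hvR, ?_⟩
  by_contra hcon
  have := hmin (par v) (Finset.mem_sdiff.2 ⟨hS.par_mem v hvS hvr, hcon⟩)
  have := hS.rk_lt v hvS hvr
  omega

/-- Edges of a tree with at least two vertices, whose endpoints have weights of ratio at most
`1 / ρ`. -/
theorem IsRooted.sum_le_two {α : Type*} [DecidableEq α] {G : SimpleGraph α} {rk : α → ℕ}
    {par : α → α} {S : Finset α} {r : α} (hS : IsRooted G rk par S r) (hcard : 2 ≤ S.card)
    (w : α → ℝ) (rho : ℝ) (hw : ∀ a, 0 ≤ w a) (h0 : 0 ≤ rho)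
    (hG : ∀ a b, G.Adj a b → rho * w a ≤ w b) :
    rho / (1 + rho) * ∑ v ∈ S, w v ≤ ∑ v ∈ S.erase r, min (w v) (w (par v)) := by
  set t := rho / (1 + rho) with ht
  have ht0 : 0 ≤ t := by positivity
  have ht1 : t * (1 + rho) = rho := by rw [ht]; field_simp
  -- `t` is the largest factor for which `t (a + b) ≤ min a b` whenever the ratio of `a` and `b` is
  -- at most `1 / ρ`. Every vertex lies on a tree edge: nonroots on the edge to the parent, the root
  -- on the edge to the child `c`.
  have hedge : ∀ v ∈ S.erase r, t * w v + t * w (par v) ≤ min (w v) (w (par v)) := by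
    intro v hv
    obtain ⟨hvr, hvS⟩ := Finset.mem_erase.1 hv
    have hadj := hS.adj v hvS hvr
    have h1 := hG _ _ hadj
    have h2 := hG _ _ hadj.symm
    have h3 : t * w v * (1 + rho) = rho * w v := by linear_combination w v * ht1
    have h4 : t * w (par v) * (1 + rho) = rho * w (par v) := by
      linear_combination w (par v) * ht1
    refine le_min ?_ ?_ <;> refine le_of_mul_le_mul_right (a := 1 + rho) ?_ (by linarith) <;>
      nlinarith [hw v, hw (par v)]
  obtain ⟨c, hcS, hcR, hcp⟩ := hS.exists_child {r} (by simp) (by rw [Finset.card_singleton]; omega)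
  have hcp : par c = r := by simpa using hcp
  have hc : c ∈ S.erase r := Finset.mem_erase.2 ⟨by simpa using hcR, hcS⟩
  refine le_trans ?_ (Finset.sum_le_sum hedge)
  rw [Finset.sum_add_distrib, ← Finset.add_sum_erase S w hS.mem, mul_add, ← Finset.mul_sum,
    add_comm]
  gcongr
  have := Finset.single_le_sum (f := fun v => t * w (par v))
    (fun v _ => mul_nonneg ht0 (hw _)) hc
  simpa [hcp] using this

/-- Edges of a tree with at least three vertices, whose endpoints have weights of ratio at most
`1 / ρ`. -/
theorem IsRooted.sum_le_three {α : Type*} [DecidableEq α] {G : SimpleGraph α} {rk : α → ℕ}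
    {par : α → α} {S : Finset α} {r : α} (hS : IsRooted G rk par S r) (hcard : 3 ≤ S.card)
    (w : α → ℝ) (rho : ℝ) (hw : ∀ a, 0 ≤ w a) (h0 : 0 ≤ rho) (h1 : rho ≤ 1)
    (hG : ∀ a b, G.Adj a b → rho * w a ≤ w b) :
    2 * rho / (2 + rho) * ∑ v ∈ S, w v ≤ ∑ v ∈ S.erase r, min (w v) (w (par v)) := by
  set t := 2 * rho / (2 + rho) with ht
  have ht0 : 0 ≤ t := by positivity
  have ht1 : t * (2 + rho) = 2 * rho := by rw [ht]; field_simp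
  -- An edge can pay `t` for one end, chosen freely, and `t / 2` for the other. It remains to see
  -- that two halves are left for the root.
  have hpair : ∀ a b, G.Adj a b → t * w a + t * (w b / 2) ≤ min (w a) (w b) := by
    intro a b hadj
    have h3 := hG _ _ hadj
    have h4 := hG _ _ hadj.symm
    have h5 : t * w a * (2 + rho) = 2 * rho * w a := by linear_combination w a * ht1
    have h6 : t * (w b / 2) * (2 + rho) = rho * w b := by linear_combination w b / 2 * ht1
    refine le_min ?_ ?_ <;> refine le_of_mul_le_mul_right (a := 2 + rho) ?_ (by linarith) <;>
      nlinarith [mul_nonneg (sub_nonneg.2 h1) (hw a), mul_nonneg (sub_nonneg.2 h1) (hw b)]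
  have hedge : ∀ v ∈ S.erase r, t * w v + t * (w (par v) / 2) ≤ min (w v) (w (par v)) := by
    intro v hv
    obtain ⟨hvr, hvS⟩ := Finset.mem_erase.1 hv
    exact hpair _ _ (hS.adj v hvS hvr)
  obtain ⟨c, hcS, hcR, hcp⟩ := hS.exists_child {r} (by simp) (by simp; omega)
  have hcp : par c = r := by simpa using hcp
  have hcr : c ≠ r := by simpa using hcR
  have hc : c ∈ S.erase r := Finset.mem_erase.2 ⟨hcr, hcS⟩
  obtain ⟨d, hdS, hdR, hdp⟩ := hS.exists_child {r, c} (by simp) (by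
    rw [Finset.card_pair hcr.symm]; omega)
  have hdr : d ≠ r := fun h => hdR (by simp [h])
  have hdc : d ≠ c := fun h => hdR (by simp [h])
  have hd : d ∈ (S.erase r).erase c :=
    Finset.mem_erase.2 ⟨hdc, Finset.mem_erase.2 ⟨hdr, hdS⟩⟩
  have hsub : ∀ v ∈ ((S.erase r).erase c).erase d, t * w v ≤ min (w v) (w (par v)) :=
    fun v hv => le_trans (le_add_of_nonneg_right (mul_nonneg ht0 (by linarith [hw (par v)])))
      (hedge v (Finset.mem_of_mem_erase (Finset.mem_of_mem_erase hv)))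
  have hs := Finset.sum_le_sum hsub
  rw [← Finset.mul_sum] at hs
  rw [← Finset.add_sum_erase S w hS.mem, ← Finset.add_sum_erase _ w hc,
    ← Finset.add_sum_erase _ w hd, ← Finset.add_sum_erase _ _ hc, ← Finset.add_sum_erase _ _ hd]
  have hdedge := hedge d (Finset.mem_of_mem_erase hd)
  -- If both `c` and `d` hang off the root, their edges pay half of it each. On a path `r, c, d` the
  -- edge `rc` is turned around to pay for `r`, and `c` receives halves from both edges.
  have hdpar : par d = r ∨ par d = c := by simpa using hdp
  rcases hdpar with hdpar | hdpar
  · have := hedge c hc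
    rw [hcp] at this ⊢
    rw [hdpar] at hdedge ⊢
    linarith
  · have := hpair r c (by have := (hS.adj c hcS hcr).symm; rwa [hcp] at this)
    rw [hcp, min_comm]
    rw [hdpar] at hdedge ⊢
    linarith

/-! ## The locality gap -/

/-- The core of the argument, for `A` and the positive part of `O` given by their bipartite
conflicts only. The parameter `q` separates small from large components, and `s` bounds the size of
the blocks of `A` that are exchanged. -/
theorem ratio_of_exchange_stable {α β : Type*} [Fintype α] [Fintype β] [DecidableEq α]
    [DecidableEq β] (N : β → Finset α) (w : α → ℝ) (u : β → ℝ) (k s q : ℕ) (x τ : ℝ)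
    (hk : 1 ≤ k) (hx0 : 0 < x) (hx1 : x ≤ 1) (hw : ∀ a, 0 ≤ w a) (hu : ∀ o, 0 < u o)
    (hN : ∀ o, (N o).card ≤ k) (hdeg : ∀ a, (Finset.univ.filter fun o => a ∈ N o).card ≤ k)
    (hs : s = q * (k * (k - 1)) + 1) (hqs : q ≤ s)
    (hlo : ∀ C : Finset β, C.card ≤ s * k → ∑ o ∈ C, u o ^ 2 ≤ ∑ b ∈ C.biUnion N, w b ^ 2)
    (hτ : τ ≤ (k - 1 / x) * (1 - x))
    (hτ' : (q = 1 ∧ τ ≤ x ^ 2 / (1 + x ^ 2)) ∨ (q = 2 ∧ τ ≤ 2 * x ^ 2 / (2 + x ^ 2))) :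
    ∑ o, u o ≤ (k + 1 - τ) / 2 * ∑ a, w a := by
  classical
  -- Exchanging `o` alone does not pay, so some member of `N o` has positive weight.
  have hπ : ∀ o, ∃ a ∈ N o, 0 < w a ∧ ∀ b ∈ N o, w b ≤ w a := by
    intro o
    have h1 := hlo {o} (by rw [Finset.card_singleton, hs]; exact hk.trans (Nat.le_mul_of_pos_left k (by omega)))
    rw [Finset.sum_singleton, Finset.singleton_biUnion] at h1
    have h2 : 0 < ∑ b ∈ N o, w b ^ 2 := (pow_pos (hu o) 2).trans_le h1
    obtain ⟨b, hb, hbw⟩ := Finset.exists_lt_of_sum_lt (f := fun _ => (0 : ℝ)) (by simpa using h2)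
    obtain ⟨a, ha, hamax⟩ := (N o).exists_max_image w ⟨b, hb⟩
    refine ⟨a, ha, lt_of_lt_of_le ?_ (hamax b hb), hamax⟩
    exact (hw b).lt_of_ne fun h => by simp [← h] at hbw
  choose π hπN hpos hmax using hπ
  set rho := x ^ 2 with hrho
  have hrho1 : rho ≤ 1 := by rw [hrho]; nlinarith
  have hrhox : rho ≤ x := by rw [hrho]; nlinarith
  have hrho0 : 0 < rho := by positivity
  set H : SimpleGraph α := SimpleGraph.fromRel fun a b =>
    ∃ o, π o = a ∧ b ∈ N o ∧ rho * w a < w b with hH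
  -- Whichever end is `π o`, both ends lie in `N o`: at most `k` choices of `o`, with `k - 1` other
  -- members each.
  have hHdeg : ∀ a, {b | H.Adj a b}.ncard ≤ k * (k - 1) := by
    intro a
    have hsub : {b | H.Adj a b} ⊆ ((Finset.univ.filter fun o => a ∈ N o).biUnion
        fun o => (N o).erase a : Finset α) := by
      rintro b ⟨hab, ⟨o, rfl, hb, -⟩ | ⟨o, rfl, ha, -⟩⟩ <;>
        simp only [Finset.coe_biUnion, Set.mem_iUnion, Finset.mem_coe, Finset.mem_filter,
          Finset.mem_univ, true_and, Finset.mem_erase]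
      · exact ⟨o, hπN o, hab.symm, hb⟩
      · exact ⟨o, ha, hab.symm, hπN o⟩
    refine (Set.ncard_le_ncard hsub).trans ?_
    rw [Set.ncard_coe_finset]
    refine (Finset.card_biUnion_le_card_mul _ _ (k - 1) fun o ho => ?_).trans
      (Nat.mul_le_mul_right _ (hdeg a))
    rw [Finset.card_erase_of_mem (Finset.mem_filter.1 ho).2]
    exact Nat.sub_le_sub_right (hN o) 1
  have hHw : ∀ a b, H.Adj a b → rho * w a ≤ w b := by
    rintro a b ⟨-, ⟨o, rfl, hb, h⟩ | ⟨o, rfl, hb, h⟩⟩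
    · exact h.le
    · have := hmax o a hb
      nlinarith [hpos o]
  let comp : H.ConnectedComponent → Finset α := fun K =>
    Finset.univ.filter fun v => H.connectedComponentMk v = K
  -- The credit charged to `o` for each member of `N o`, per unit of its weight.
  set c : α → ℝ := fun a => if q < (comp (H.connectedComponentMk a)).card then 1 else x with hcdef
  have hcx : ∀ a, x ≤ c a := fun a => by simp only [hcdef]; split_ifs <;> linarith
  have hc0 : ∀ a, 0 ≤ c a := fun a => hx0.le.trans (hcx a)
  set p : β → ℝ := fun o => 2 * u o - ∑ b ∈ N o, c b * w b with hp
  have hcardB : ∀ B : Finset α, B.card ≤ s → (Finset.univ.filter fun o => π o ∈ B).card ≤ s * k := by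
    intro B hB
    refine le_trans ?_ (Nat.mul_le_mul_right k hB)
    have : (Finset.univ.filter fun o => π o ∈ B) ⊆
        B.biUnion fun a => Finset.univ.filter fun o => a ∈ N o := by
      intro o ho
      rw [Finset.mem_filter] at ho
      exact Finset.mem_biUnion.2 ⟨π o, ho.2, Finset.mem_filter.2 ⟨Finset.mem_univ _, hπN o⟩⟩
    exact (Finset.card_le_card this).trans (Finset.card_biUnion_le_card_mul _ _ _ fun a _ => hdeg a)
  -- neighbours that are not heavier than the threshold allow the credit `x`
  have hlight : ∀ o b, b ∈ N o → b ≠ π o → ¬ H.Adj (π o) b → w b ≤ rho * w (π o) := by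
    intro o b hb hne hadj
    by_contra hcon
    push Not at hcon
    exact hadj ⟨hne.symm, Or.inl ⟨o, rfl, hb, hcon⟩⟩
  have hsame : ∀ {a b}, H.Adj a b → H.connectedComponentMk a = H.connectedComponentMk b :=
    fun h => SimpleGraph.ConnectedComponent.sound h.reachable
  -- The surplus collected at `a`. If it sums to at most `0`, double counting of the credits gives
  -- the theorem; this is shown for each component separately.
  set f : α → ℝ := fun a =>
    ∑ o with π o = a, p o + (k * c a - (k + 1 - τ)) * w a with hf
  have hfsum : ∀ B : Finset α, ∑ a ∈ B, f a =
      ∑ o with π o ∈ B, p o + ∑ a ∈ B, (k * c a - (k + 1 - τ)) * w a := by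
    intro B
    rw [hf, Finset.sum_add_distrib, Finset.sum_fiberwise_eq_sum_filter]
  have hsmall : ∀ K, (comp K).card ≤ q → ∑ a ∈ comp K, f a ≤ 0 := by
    intro K hK
    have hcK : ∀ a ∈ comp K, c a = x := by
      intro a ha
      have : H.connectedComponentMk a = K := (Finset.mem_filter.1 ha).2
      simp only [hcdef, this, if_neg (not_lt.2 hK)]
    have hb := block_bound N w c u π (s * k) x hw hmax hpos hlo (comp K)
      (hcardB _ (hK.trans hqs)) (by
      intro o ho b hb
      obtain ⟨hbN, hbK⟩ := Finset.mem_sdiff.1 hb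
      have hl := hlight o b hbN (fun h => hbK (h ▸ ho)) fun h => hbK (by
        refine Finset.mem_filter.2 ⟨Finset.mem_univ _, ?_⟩
        rw [← hsame h]; exact (Finset.mem_filter.1 ho).2)
      have := mul_le_mul_of_nonneg_left (hcx b) hx0.le
      nlinarith [hpos o])
    have h1 : ∑ o with π o ∈ comp K, p o ≤ ∑ o with π o ∈ comp K,
        (2 * u o - x * w (π o) - ∑ b ∈ N o \ comp K, c b * w b) := by
      refine Finset.sum_le_sum fun o ho => ?_
      have hoK := (Finset.mem_filter.1 ho).2
      simp only [hp]
      rw [← Finset.sum_inter_add_sum_sdiff (N o) (comp K)]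
      have : x * w (π o) ≤ ∑ b ∈ N o ∩ comp K, c b * w b := by
        rw [← hcK _ hoK]
        exact Finset.single_le_sum (f := fun b => c b * w b)
          (fun b _ => mul_nonneg (hc0 b) (hw b)) (Finset.mem_inter.2 ⟨hπN o, hoK⟩)
      linarith
    have h2 := (mul_le_mul_of_nonneg_left h1 hx0.le).trans hb
    have h6 : ∑ a ∈ comp K, (k * c a - (k + 1 - τ)) * w a =
        (k * x - (k + 1 - τ)) * ∑ a ∈ comp K, w a := by
      rw [Finset.mul_sum]
      exact Finset.sum_congr rfl fun a ha => by rw [hcK a ha]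
    rw [hfsum, h6]
    have hW : 0 ≤ ∑ b ∈ comp K, w b := Finset.sum_nonneg fun a _ => hw a
    -- This is the hypothesis `τ ≤ (k - 1/x)(1 - x)` rearranged; `block_bound` with `λ = x` costs
    -- the factor `1 / x`.
    have h3 : k * x - (k + 1 - τ) ≤ -(1 / x) := by
      have : (k - 1 / x) * (1 - x) = k + 1 - k * x - 1 / x := by field_simp; ring
      linarith
    have h4 := mul_le_mul_of_nonneg_right h3 hW
    have h5 : ∑ o with π o ∈ comp K, p o ≤ 1 / x * ∑ b ∈ comp K, w b := by
      rw [div_mul_eq_mul_div, one_mul, le_div_iff₀ hx0]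
      linarith
    linarith
  have hlarge : ∀ K, q + 1 ≤ (comp K).card → ∑ a ∈ comp K, f a ≤ 0 := by
    intro K hK
    obtain ⟨rk, par, r, hroot⟩ := exists_rooted H K
    have hcK : ∀ a ∈ comp K, c a = 1 := by
      intro a ha
      have : H.connectedComponentMk a = K := (Finset.mem_filter.1 ha).2
      simp only [hcdef, this]
      exact if_pos hK
    refine sum_nonpos_of_rooted H rk par q (k * (k - 1)) hHdeg f (comp K) ?_ (comp K)
      subset_rfl r hroot hK
    clear hroot r
    intro S hSK r hS hcard hcard'
    -- Neighbours outside the piece are either in the same component, with credit `1`, or light,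
    -- with weight at most `x² w(π o) ≤ c b w(π o)`. So `λ = 1` is admissible although the piece is
    -- not a whole component.
    have hb := block_bound N w c u π (s * k) 1 hw hmax hpos hlo S
      (hcardB _ (hcard'.trans hs.ge)) (by
      intro o ho b hb
      obtain ⟨hbN, hbS⟩ := Finset.mem_sdiff.1 hb
      by_cases hadj : H.Adj (π o) b
      · rw [hcK b (Finset.mem_filter.2 ⟨Finset.mem_univ _, by
          rw [← hsame hadj]; exact (Finset.mem_filter.1 (hSK ho)).2⟩)]
        simpa using hmax o b hbN
      · have hl := hlight o b hbN (fun h => hbS (h ▸ ho)) hadj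
        nlinarith [hpos o, hcx b])
    have h1 : ∀ o, π o ∈ S → p o = 2 * u o - 1 * w (π o) - ∑ b ∈ N o \ S, c b * w b
        - ∑ b ∈ (N o ∩ S).erase (π o), w b := by
      intro o ho
      have h2 : ∑ b ∈ N o ∩ S, c b * w b = ∑ b ∈ N o ∩ S, w b :=
        Finset.sum_congr rfl fun b hb => by
          rw [hcK b (hSK (Finset.mem_inter.1 hb).2), one_mul]
      simp only [hp]
      rw [← Finset.sum_inter_add_sum_sdiff (N o) S, h2,
        ← Finset.add_sum_erase _ _ (Finset.mem_inter.2 ⟨hπN o, ho⟩)]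
      ring
    -- What is saved inside the piece: each tree edge comes from some `o` with one end equal to `π
    -- o` and the other in `N o`.
    have hedges : ∑ v ∈ S.erase r, min (w v) (w (par v)) ≤
        ∑ o with π o ∈ S, ∑ b ∈ (N o ∩ S).erase (π o), w b := by
      have hex : ∀ v ∈ S.erase r, ∃ e : (_ : β) × α, (π e.1 ∈ S ∧ e.2 ∈ (N e.1 ∩ S).erase (π e.1)) ∧
          ((π e.1 = v ∧ e.2 = par v) ∨ (π e.1 = par v ∧ e.2 = v)) := by
        intro v hv
        obtain ⟨hvr, hvS⟩ := Finset.mem_erase.1 hv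
        have hpS := hS.par_mem v hvS hvr
        obtain ⟨hne, ⟨o, ho, hb, -⟩ | ⟨o, ho, hb, -⟩⟩ := hS.adj v hvS hvr
        · exact ⟨⟨o, par v⟩, ⟨ho ▸ hvS, Finset.mem_erase.2 ⟨ho ▸ hne.symm,
            Finset.mem_inter.2 ⟨hb, hpS⟩⟩⟩, Or.inl ⟨ho, rfl⟩⟩
        · exact ⟨⟨o, v⟩, ⟨ho ▸ hpS, Finset.mem_erase.2 ⟨ho ▸ hne,
            Finset.mem_inter.2 ⟨hb, hvS⟩⟩⟩, Or.inr ⟨ho, rfl⟩⟩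
      rcases (S.erase r).eq_empty_or_nonempty with h0 | ⟨v₀, hv₀⟩
      · rw [h0, Finset.sum_empty]
        exact Finset.sum_nonneg fun _ _ => Finset.sum_nonneg fun _ _ => hw _
      have : Nonempty ((_ : β) × α) := ⟨(hex v₀ hv₀).choose⟩
      choose! e he using hex
      -- The pair `(o, b)` determines the edge `{π o, b}`, and the end of larger rank is the child.
      have hinj : Set.InjOn e (S.erase r) := by
        intro v hv v' hv' hee
        obtain ⟨hvr, hvS⟩ := Finset.mem_erase.1 hv
        obtain ⟨hvr', hvS'⟩ := Finset.mem_erase.1 hv'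
        have h3 := hS.rk_lt v hvS hvr
        have h4 := hS.rk_lt v' hvS' hvr'
        have h5 := (he v hv).2
        have h6 := (he v' hv').2
        rw [← hee] at h6
        rcases h5 with ⟨h5, h5'⟩ | ⟨h5, h5'⟩ <;> rcases h6 with ⟨h6, h6'⟩ | ⟨h6, h6'⟩
        · exact h5.symm.trans h6
        · have := congrArg rk (h5.symm.trans h6)
          have := congrArg rk (h5'.symm.trans h6')
          omega
        · have := congrArg rk (h5.symm.trans h6)
          have := congrArg rk (h5'.symm.trans h6')
          omega
        · exact h5'.symm.trans h6'
      rw [Finset.sum_sigma']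
      calc _ ≤ ∑ v ∈ S.erase r, w (e v).2 := Finset.sum_le_sum fun v hv => by
            rcases (he v hv).2 with ⟨-, h⟩ | ⟨-, h⟩ <;> rw [h]
            · exact min_le_right _ _
            · exact min_le_left _ _
        _ = ∑ y ∈ (S.erase r).image e, w y.2 := 
            (Finset.sum_image (f := fun y => w y.2) hinj).symm
        _ ≤ _ := Finset.sum_le_sum_of_subset_of_nonneg (fun y hy => by
            obtain ⟨v, hv, rfl⟩ := Finset.mem_image.1 hy
            exact Finset.mem_sigma.2 ⟨Finset.mem_filter.2 ⟨Finset.mem_univ _, (he v hv).1.1⟩,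
              (he v hv).1.2⟩) fun _ _ _ => hw _
    have hW : 0 ≤ ∑ v ∈ S, w v := Finset.sum_nonneg fun a _ => hw a
    have htree : τ * ∑ v ∈ S, w v ≤ ∑ v ∈ S.erase r, min (w v) (w (par v)) := by
      rcases hτ' with ⟨rfl, hτ'⟩ | ⟨rfl, hτ'⟩
      · exact (mul_le_mul_of_nonneg_right hτ' hW).trans
          (hS.sum_le_two hcard w rho hw hrho0.le hHw)
      · exact (mul_le_mul_of_nonneg_right hτ' hW).trans
          (hS.sum_le_three hcard w rho hw hrho0.le hrho1 hHw)
    have h2 : ∑ o with π o ∈ S, p o = ∑ o with π o ∈ S,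
        (2 * u o - 1 * w (π o) - ∑ b ∈ N o \ S, c b * w b)
        - ∑ o with π o ∈ S, ∑ b ∈ (N o ∩ S).erase (π o), w b := by
      rw [← Finset.sum_sub_distrib]
      exact Finset.sum_congr rfl fun o ho => h1 o (Finset.mem_filter.1 ho).2
    have h6 : ∑ a ∈ S, (k * c a - (k + 1 - τ)) * w a = (τ - 1) * ∑ a ∈ S, w a := by
      rw [Finset.mul_sum]
      exact Finset.sum_congr rfl fun a ha => by rw [hcK a (hSK ha)]; ring
    rw [hfsum, h6, h2]
    linarith
  have htotal : ∑ a, f a ≤ 0 := by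
    rw [← Finset.sum_fiberwise Finset.univ H.connectedComponentMk f]
    refine Finset.sum_nonpos fun K _ => ?_
    rcases le_or_gt (comp K).card q with h | h
    · exact hsmall K h
    · exact hlarge K h
  -- Each member of `A` is charged by at most `k` members of `O`.
  have hdouble : ∑ o, ∑ b ∈ N o, c b * w b ≤ ∑ a, k * c a * w a := by
    rw [Finset.sum_comm' (t' := Finset.univ)
      (s' := fun a => Finset.univ.filter fun o => a ∈ N o) (by simp)]
    refine Finset.sum_le_sum fun a _ => ?_
    rw [Finset.sum_const, nsmul_eq_mul, mul_assoc]
    exact mul_le_mul_of_nonneg_right (by exact_mod_cast hdeg a) (mul_nonneg (hc0 a) (hw a))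
  have h1 := hfsum Finset.univ
  rw [h1] at htotal
  simp only [Finset.mem_univ, Finset.filter_true, hp, Finset.sum_sub_distrib, sub_mul,
    ← Finset.mul_sum] at htotal
  linarith

/-! ### Local optima in claw-free graphs -/

theorem mem_nbhd {V : Type*} {G : SimpleGraph V} {C A : Finset V} {b : V} :
    b ∈ nbhd G C A ↔ b ∈ A ∧ ((∃ a ∈ C, G.Adj a b) ∨ b ∈ C) := by
  classical
  rw [nbhd, Finset.mem_filter]

/-- If `c` belongs to the independent set `S`, it is the only vertex counted; otherwise the counted
vertices are talons of a claw with center `c`. -/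
theorem IsClawFree.card_filter_le {V : Type*} [DecidableEq V] {G : SimpleGraph V}
    [DecidableRel G.Adj] {k : ℕ}
    (hG : IsClawFree G (k + 1)) (hk : 1 ≤ k) {S : Finset V} (hS : G.IsIndepSet (S : Set V))
    (c : V) : (S.filter fun a => a = c ∨ G.Adj c a).card ≤ k := by
  by_cases hc : c ∈ S
  · have : (S.filter fun a => a = c ∨ G.Adj c a) ⊆ {c} := by
      intro a ha
      obtain ⟨haS, rfl | h⟩ := Finset.mem_filter.1 ha
      · simp
      · exact absurd h (hS hc haS h.ne)
    exact (Finset.card_le_card this).trans (by simpa using hk)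
  by_contra hcon
  push Not at hcon
  obtain ⟨T, hT, hTk⟩ := Finset.exists_subset_card_eq hcon
  refine hG ⟨c, T, hTk, fun t ht => ?_, fun a ha b hb hab => ?_⟩
  · obtain ⟨htS, rfl | h⟩ := Finset.mem_filter.1 (hT ht)
    · exact absurd htS hc
    · exact h
  · exact hS (Finset.mem_filter.1 (hT ha)).1 (Finset.mem_filter.1 (hT hb)).1 hab

/-- The locality gap, in terms of a parameter `x = √(1 - ε)`. -/
theorem ratio_of_local_optimum {V : Type*} [DecidableEq V] (G : SimpleGraph V) (w : V → ℝ)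
    (k s q : ℕ) (x τ : ℝ) (hG : IsClawFree G (k + 1)) (hw : ∀ v, 0 ≤ w v)
    (hk : 1 ≤ k) (hx0 : 0 < x) (hx1 : x ≤ 1) (hs : s = q * (k * (k - 1)) + 1) (hqs : q ≤ s)
    (hτ : τ ≤ (k - 1 / x) * (1 - x))
    (hτ' : (q = 1 ∧ τ ≤ x ^ 2 / (1 + x ^ 2)) ∨ (q = 2 ∧ τ ≤ 2 * x ^ 2 / (2 + x ^ 2)))
    (A O : Finset V) (hA : G.IsIndepSet (A : Set V)) (hO : G.IsIndepSet (O : Set V))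
    (hlo : ∀ C ⊆ O, Disjoint C A → C.card ≤ s * k →
      ∑ v ∈ C, w v ^ 2 ≤ ∑ v ∈ nbhd G C A, w v ^ 2) :
    ∑ v ∈ O, w v ≤ (k + 1 - τ) / 2 * ∑ v ∈ A, w v := by
  classical
  -- Vertices of weight `0` are dropped, since `ratio_of_exchange_stable` needs positive weights to
  -- find `π o`.
  set O' := O.filter fun v => 0 < w v with hO'
  have hOO' : ∑ v ∈ O, w v = ∑ v ∈ O', w v := by
    rw [hO', Finset.sum_filter]
    refine Finset.sum_congr rfl fun v _ => ?_
    split_ifs with h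
    · rfl
    · exact le_antisymm (not_lt.1 h) (hw v)
  rw [hOO', ← Finset.sum_coe_sort O', ← Finset.sum_coe_sort A]
  have hO'ind : G.IsIndepSet (O' : Set V) := fun a ha b hb =>
    hO (Finset.mem_filter.1 ha).1 (Finset.mem_filter.1 hb).1
  let N : O' → Finset A := fun o => Finset.univ.filter fun a => a.1 = o.1 ∨ G.Adj o.1 a.1
  refine ratio_of_exchange_stable (α := A) (β := O') N (fun a => w a) (fun o => w o) k s q x τ hk
    hx0 hx1 (fun a => hw a) (fun o => (Finset.mem_filter.1 o.2).2) (fun o => ?_) (fun a => ?_)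
    hs hqs (fun C hC => ?_) hτ hτ'
  · refine le_trans ?_ (hG.card_filter_le hk hA o.1)
    refine Finset.card_le_card_of_injOn Subtype.val (fun a ha => ?_) Subtype.val_injective.injOn
    simpa [N] using ha
  · refine le_trans ?_ (hG.card_filter_le hk hO'ind a.1)
    refine Finset.card_le_card_of_injOn Subtype.val (fun o ho => ?_) Subtype.val_injective.injOn
    have ho' : a.1 = o.1 ∨ G.Adj o.1 a.1 := by simpa [N] using ho
    exact Finset.mem_coe.2 (Finset.mem_filter.2 ⟨o.2, ho'.imp Eq.symm SimpleGraph.Adj.symm⟩)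
  · set C' : Finset V := C.map (Function.Embedding.subtype _) with hC'
    have hC'O : C' ⊆ O := by
      intro v hv
      obtain ⟨o, -, rfl⟩ := Finset.mem_map.1 hv
      exact (Finset.mem_filter.1 o.2).1
    have h1 := hlo (C' \ A) (Finset.sdiff_subset.trans hC'O) Finset.sdiff_disjoint
      ((Finset.card_le_card Finset.sdiff_subset).trans (by rwa [hC', Finset.card_map]))
    have h2 : ∑ o ∈ C, w o ^ 2 = ∑ v ∈ C', w v ^ 2 := by
      rw [hC', Finset.sum_map]; rfl
    have h3 : ∑ b ∈ C.biUnion N, w b ^ 2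
        = ∑ v ∈ (C.biUnion N).map (Function.Embedding.subtype _), w v ^ 2 := by
      rw [Finset.sum_map]; rfl
    rw [h2, h3, ← Finset.sum_inter_add_sum_sdiff C' A]
    refine (add_le_add_right h1 _).trans ?_
    rw [← Finset.sum_union]
    · refine Finset.sum_le_sum_of_subset_of_nonneg (fun b hb => ?_) fun _ _ _ => sq_nonneg _
      have hmk : ∀ (o : O') (ho : o ∈ C) (hbA : b ∈ A), (b = o.1 ∨ G.Adj o.1 b) →
          b ∈ (C.biUnion N).map (Function.Embedding.subtype _) := fun o ho hbA h =>
        Finset.mem_map.2 ⟨⟨b, hbA⟩, Finset.mem_biUnion.2 ⟨o, ho, by simpa [N] using h⟩, rfl⟩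
      rcases Finset.mem_union.1 hb with hb | hb
      · obtain ⟨hbC, hbA⟩ := Finset.mem_inter.1 hb
        obtain ⟨o, ho, rfl⟩ := Finset.mem_map.1 hbC
        exact hmk o ho hbA (Or.inl rfl)
      · obtain ⟨hbA, ⟨a, ha, hab⟩ | hb⟩ := mem_nbhd.1 hb
        · obtain ⟨o, ho, rfl⟩ := Finset.mem_map.1 (Finset.mem_sdiff.1 ha).1
          exact hmk o ho hbA (Or.inr hab)
        · exact absurd hbA (Finset.mem_sdiff.1 hb).2
    · rw [Finset.disjoint_left]
      intro b hb hb'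
      obtain ⟨hbC, hbA⟩ := Finset.mem_inter.1 hb
      obtain ⟨-, ⟨a, ha, hab⟩ | hb⟩ := mem_nbhd.1 hb'
      · exact hO (hC'O (Finset.mem_sdiff.1 ha).1) (hC'O hbC) hab.ne hab
      · exact (Finset.mem_sdiff.1 hb).2 hbA

/-! ## The constants -/

theorem sqrt_one_sub_mem {ε : ℝ} (h : ε ∈ Set.Icc (0 : ℝ) (1 / 2)) :
    0 < √(1 - ε) ∧ √(1 - ε) ≤ 1 ∧ √(1 - ε) ^ 2 = 1 - ε := by
  obtain ⟨h0, h1⟩ := h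
  exact ⟨Real.sqrt_pos.2 (by linarith), Real.sqrt_le_one.2 (by linarith),
    Real.sq_sqrt (by linarith)⟩

theorem continuousOn_gainTwo (k : ℕ) : ContinuousOn (gainTwo k) (Set.Icc 0 (1 / 2)) := by
  unfold gainTwo
  refine ContinuousOn.inf (ContinuousOn.div (by fun_prop) (by fun_prop) fun ε h => ?_)
    (ContinuousOn.mul (ContinuousOn.sub (by fun_prop)
      (ContinuousOn.div (by fun_prop) (by fun_prop) fun ε h => ?_)) (by fun_prop))
  · have := h.2; intro h2; linarith
  · exact (sqrt_one_sub_mem h).1.ne'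

theorem continuousOn_gainThree (k : ℕ) : ContinuousOn (gainThree k) (Set.Icc 0 (1 / 2)) := by
  unfold gainThree
  have h1 : ContinuousOn (fun ε : ℝ => 1 / √(1 - ε)) (Set.Icc 0 (1 / 2)) :=
    ContinuousOn.div (by fun_prop) (by fun_prop) fun ε h => (sqrt_one_sub_mem h).1.ne'
  refine ContinuousOn.inf (ContinuousOn.div (by fun_prop) (by fun_prop) fun ε h => ?_)
    (ContinuousOn.inf (ContinuousOn.mul (ContinuousOn.sub (by fun_prop) h1) (by fun_prop))
      (ContinuousOn.sub (by fun_prop) h1))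
  have := h.2; intro h2; linarith

theorem isGreatest_tauTwo (k : ℕ) :
    IsGreatest (gainTwo k '' Set.Icc 0 (1 / 2)) (tauTwo k) :=
  (isCompact_Icc.image_of_continuousOn (continuousOn_gainTwo k)).isGreatest_sSup
    ((Set.nonempty_Icc.2 (by norm_num)).image _)

theorem isGreatest_tauThree (k : ℕ) :
    IsGreatest (gainThree k '' Set.Icc 0 (1 / 2)) (tauThree k) :=
  (isCompact_Icc.image_of_continuousOn (continuousOn_gainThree k)).isGreatest_sSup
    ((Set.nonempty_Icc.2 (by norm_num)).image _)

theorem monotone_tauTwo : Monotone tauTwo := by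
  intro k k' hk
  obtain ⟨ε, hε, h⟩ := (isGreatest_tauTwo k).1
  rw [← h]
  refine le_trans ?_ ((isGreatest_tauTwo k').2 ⟨ε, hε, rfl⟩)
  refine min_le_min le_rfl (mul_le_mul_of_nonneg_right ?_ ?_)
  · have : (k : ℝ) ≤ k' := by exact_mod_cast hk
    linarith
  · linarith [(sqrt_one_sub_mem hε).2.1]

theorem monotone_tauThree : Monotone tauThree := by
  intro k k' hk
  obtain ⟨ε, hε, h⟩ := (isGreatest_tauThree k).1
  rw [← h]
  refine le_trans ?_ ((isGreatest_tauThree k').2 ⟨ε, hε, rfl⟩)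
  refine min_le_min le_rfl (min_le_min (mul_le_mul_of_nonneg_right ?_ ?_) le_rfl)
  · have : (k : ℝ) ≤ k' := by exact_mod_cast hk
    linarith
  · linarith [(sqrt_one_sub_mem hε).2.1]

/-- The substitution `x = √(1 - ε)` at a maximizer removes the square roots. -/
theorem tauTwo_eq (k : ℕ) : ∃ x : ℝ, 0 < x ∧ x ≤ 1 ∧
    tauTwo k = min (x ^ 2 / (1 + x ^ 2)) ((k - 1 / x) * (1 - x)) := by
  obtain ⟨ε, hε, h⟩ := (isGreatest_tauTwo k).1
  obtain ⟨h0, h1, h2⟩ := sqrt_one_sub_mem hε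
  refine ⟨_, h0, h1, ?_⟩
  rw [← h, gainTwo, h2]
  ring_nf

theorem tauThree_eq (k : ℕ) : ∃ x : ℝ, 0 < x ∧ x ≤ 1 ∧ tauThree k =
    min (2 * x ^ 2 / (2 + x ^ 2)) (min ((k - 1 / x) * (1 - x)) (2 - 1 / x)) := by
  obtain ⟨ε, hε, h⟩ := (isGreatest_tauThree k).1
  obtain ⟨h0, h1, h2⟩ := sqrt_one_sub_mem hε
  refine ⟨_, h0, h1, ?_⟩
  rw [← h, gainThree, h2]
  ring_nf

theorem le_tauTwo (k : ℕ) {x : ℝ} (hx0 : 0 < x) (hx : 1 / 2 ≤ x ^ 2) (hx1 : x ≤ 1) :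
    min (x ^ 2 / (1 + x ^ 2)) ((k - 1 / x) * (1 - x)) ≤ tauTwo k := by
  have h := (isGreatest_tauTwo k).2 ⟨1 - x ^ 2, ⟨by nlinarith, by linarith⟩, rfl⟩
  rw [gainTwo, sub_sub_cancel, Real.sqrt_sq hx0.le] at h
  convert h using 3
  ring

theorem le_tauThree (k : ℕ) {x : ℝ} (hx0 : 0 < x) (hx : 1 / 2 ≤ x ^ 2) (hx1 : x ≤ 1) :
    min (2 * x ^ 2 / (2 + x ^ 2)) (min ((k - 1 / x) * (1 - x)) (2 - 1 / x)) ≤ tauThree k := by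
  have h := (isGreatest_tauThree k).2 ⟨1 - x ^ 2, ⟨by nlinarith, by linarith⟩, rfl⟩
  rw [gainThree, sub_sub_cancel, Real.sqrt_sq hx0.le] at h
  convert h using 3
  ring

theorem tauTwo_le (k : ℕ) : tauTwo k ≤ 1 / 2 := by
  obtain ⟨x, hx0, hx1, h⟩ := tauTwo_eq k
  rw [h]
  refine (min_le_left _ _).trans ?_
  rw [div_le_div_iff₀ (by positivity) (by norm_num)]
  nlinarith

theorem tauThree_le (k : ℕ) : tauThree k ≤ 2 / 3 := by
  obtain ⟨x, hx0, hx1, h⟩ := tauThree_eq k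
  rw [h]
  refine (min_le_left _ _).trans ?_
  rw [div_le_div_iff₀ (by positivity) (by norm_num)]
  nlinarith

/-- For `k = 1` no gain is claimed; this case is treated separately below. -/
theorem gain_one_nonpos {x : ℝ} (hx0 : 0 < x) (hx1 : x ≤ 1) :
    (((1 : ℕ) : ℝ) - 1 / x) * (1 - x) ≤ 0 := by
  refine mul_nonpos_of_nonpos_of_nonneg ?_ (by linarith)
  have : 1 ≤ 1 / x := by rwa [le_div_iff₀ hx0, one_mul]
  push_cast
  linarith

theorem tauTwo_one_le : tauTwo 1 ≤ 0 := by
  obtain ⟨x, hx0, hx1, h⟩ := tauTwo_eq 1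
  rw [h]
  exact (min_le_right _ _).trans (gain_one_nonpos hx0 hx1)

theorem tauThree_one_le : tauThree 1 ≤ 0 := by
  obtain ⟨x, hx0, hx1, h⟩ := tauThree_eq 1
  rw [h]
  exact ((min_le_right _ _).trans (min_le_left _ _)).trans (gain_one_nonpos hx0 hx1)

open Filter Topology in
theorem eventually_lt_gain (a : ℝ) {x : ℝ} (hx1 : x < 1) :
    ∀ᶠ k : ℕ in atTop, a < (k - 1 / x) * (1 - x) := by
  refine Tendsto.eventually_gt_atTop ?_ a
  refine Tendsto.atTop_mul_const (by linarith) ?_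
  exact tendsto_atTop_add_const_right _ _ tendsto_natCast_atTop_atTop

open Filter Topology in
theorem exists_lt_one_of_eventually {P : ℝ → Prop} (h : ∀ᶠ x in 𝓝 1, P x) :
    ∃ x : ℝ, 0 < x ∧ 1 / 2 ≤ x ^ 2 ∧ x < 1 ∧ P x := by
  have h1 : ∀ᶠ x : ℝ in 𝓝 1, 0 < x := lt_mem_nhds one_pos
  have h2 : ∀ᶠ x : ℝ in 𝓝 1, 1 / 2 < x ^ 2 :=
    (continuous_pow 2).continuousAt.eventually (lt_mem_nhds (by norm_num))
  have h3 : ∀ᶠ x : ℝ in 𝓝[<] 1, x < 1 := self_mem_nhdsWithin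
  obtain ⟨x, ⟨⟨h1, h2⟩, h⟩, h3⟩ :=
    ((((h1.and h2).and h).filter_mono nhdsWithin_le_nhds).and h3).exists
  exact ⟨x, h1, h2.le, h3, h⟩

-- The upper bound `1/2` is the value of the first term at `x = 1`. Conversely, a fixed `x < 1`
-- close to `1` brings the first term close to `1/2`, and for large `k` the second term exceeds it.
open Filter Topology in
theorem tendsto_tauTwo : Tendsto tauTwo atTop (𝓝 (1 / 2)) := by
  refine tendsto_order.2 ⟨fun a ha => ?_, fun a ha =>
    Eventually.of_forall fun k => (tauTwo_le k).trans_lt ha⟩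
  have hc : ContinuousAt (fun x : ℝ => x ^ 2 / (1 + x ^ 2)) 1 :=
    ContinuousAt.div (by fun_prop) (by fun_prop) (by norm_num)
  obtain ⟨x, hx0, hx, hx1, hax⟩ := exists_lt_one_of_eventually
    (hc.eventually (lt_mem_nhds (a := a) (by norm_num; linarith)))
  filter_upwards [eventually_lt_gain a hx1] with k hk
  exact (lt_min hax hk).trans_le (le_tauTwo k hx0 hx hx1.le)

open Filter Topology in
theorem tendsto_tauThree : Tendsto tauThree atTop (𝓝 (2 / 3)) := by
  refine tendsto_order.2 ⟨fun a ha => ?_, fun a ha =>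
    Eventually.of_forall fun k => (tauThree_le k).trans_lt ha⟩
  have hc : ContinuousAt (fun x : ℝ => 2 * x ^ 2 / (2 + x ^ 2)) 1 :=
    ContinuousAt.div (by fun_prop) (by fun_prop) (by norm_num)
  have hc' : ContinuousAt (fun x : ℝ => 2 - 1 / x) 1 :=
    continuousAt_const.sub (ContinuousAt.div (by fun_prop) (by fun_prop) (by norm_num))
  obtain ⟨x, hx0, hx, hx1, hax, hax'⟩ := exists_lt_one_of_eventually
    ((hc.eventually (lt_mem_nhds (a := a) (by norm_num; linarith))).and
      (hc'.eventually (lt_mem_nhds (a := a) (by norm_num; linarith))))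
  filter_upwards [eventually_lt_gain a hx1] with k hk
  exact (lt_min hax (lt_min hk hax')).trans_le (le_tauThree k hx0 hx hx1.le)

/-- The first term increases in `x`, and in the relevant range the second decreases; they cross near
`0.78`. The bounds translate into `1.81 < α ≤ 1.811`. -/
theorem tauTwo_three_bounds : 0.378 ≤ tauTwo 3 ∧ tauTwo 3 < 0.38 := by
  constructor
  · refine le_trans (le_min ?_ ?_) (le_tauTwo 3 (x := 0.7797) ?_ ?_ ?_) <;> norm_num
  · obtain ⟨x, hx0, hx1, h⟩ := tauTwo_eq 3
    rw [h]
    -- To the left of this point the first term is below `0.38`, to the right the second.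
    rcases lt_or_ge x 0.7828 with hx | hx
    · refine (min_le_left _ _).trans_lt ?_
      rw [div_lt_iff₀ (by positivity)]
      norm_num at *
      nlinarith
    · refine (min_le_right _ _).trans_lt ?_
      have h1 : ((3 : ℕ) - 1 / x) * (1 - x) * x = (3 * x - 1) * (1 - x) := by
        field_simp; push_cast; ring
      refine lt_of_mul_lt_mul_right (a := x) ?_ hx0.le
      rw [h1]
      norm_num at *
      nlinarith

theorem tauThree_three_bounds : 0.428 ≤ tauThree 3 ∧ tauThree 3 < 0.43 := by
  constructor
  · refine le_trans (le_min ?_ (le_min ?_ ?_)) (le_tauThree 3 (x := 0.738) ?_ ?_ ?_) <;> norm_num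
  · obtain ⟨x, hx0, hx1, h⟩ := tauThree_eq 3
    rw [h]
    rcases lt_or_ge x 0.7401 with hx | hx
    · refine (min_le_left _ _).trans_lt ?_
      rw [div_lt_iff₀ (by positivity)]
      norm_num at *
      nlinarith
    · refine ((min_le_right _ _).trans (min_le_left _ _)).trans_lt ?_
      have h1 : ((3 : ℕ) - 1 / x) * (1 - x) * x = (3 * x - 1) * (1 - x) := by
        field_simp; push_cast; ring
      refine lt_of_mul_lt_mul_right (a := x) ?_ hx0.le
      rw [h1]
      norm_num at *
      nlinarith

/-- The two admissible choices of the exchange size and the gain. -/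
def IsParam (k s : ℕ) (τ : ℝ) : Prop :=
  (s = k * (k - 1) + 1 ∧ τ = tauTwo k) ∨ (s = 2 * k * (k - 1) + 1 ∧ τ = tauThree k)

theorem IsParam.le_two_thirds {k s : ℕ} {τ : ℝ} (h : IsParam k s τ) : τ ≤ 2 / 3 := by
  rcases h with ⟨-, rfl⟩ | ⟨-, rfl⟩
  · linarith [tauTwo_le k]
  · exact tauThree_le k

theorem IsParam.one {s : ℕ} {τ : ℝ} (h : IsParam 1 s τ) : s = 1 ∧ τ ≤ 0 := by
  rcases h with ⟨rfl, rfl⟩ | ⟨rfl, rfl⟩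
  · exact ⟨rfl, tauTwo_one_le⟩
  · exact ⟨rfl, tauThree_one_le⟩

theorem IsParam.ratio {V : Type*} [DecidableEq V] {G : SimpleGraph V} {w : V → ℝ}
    {k s : ℕ} {τ : ℝ} (h : IsParam k s τ) (hk : 1 ≤ k) (hG : IsClawFree G (k + 1))
    (hw : ∀ v, 0 ≤ w v)
    {A O : Finset V} (hA : G.IsIndepSet (A : Set V)) (hO : G.IsIndepSet (O : Set V))
    (hlo : ∀ C ⊆ O, Disjoint C A → C.card ≤ s * k →
      ∑ v ∈ C, w v ^ 2 ≤ ∑ v ∈ nbhd G C A, w v ^ 2) :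
    ∑ v ∈ O, w v ≤ (k + 1 - τ) / 2 * ∑ v ∈ A, w v := by
  rcases h with ⟨rfl, rfl⟩ | ⟨rfl, rfl⟩
  · obtain ⟨x, hx0, hx1, h⟩ := tauTwo_eq k
    exact ratio_of_local_optimum G w k _ 1 x _ hG hw hk hx0 hx1 (by ring) (by omega)
      (h.le.trans (min_le_right _ _)) (Or.inl ⟨rfl, h.le.trans (min_le_left _ _)⟩) A O hA hO hlo
  · obtain ⟨x, hx0, hx1, h⟩ := tauThree_eq k
    have h2 := (h.le.trans (min_le_right _ _)).trans (min_le_left _ _)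
    -- For `k = 1` the exchange size is `s = 1`, so `q = 2` violates `q ≤ s`; as `τ ≤ 0`, `q = 1`
    -- suffices.
    rcases hk.eq_or_lt with rfl | hk2
    · exact ratio_of_local_optimum G w 1 _ 1 x _ hG hw le_rfl hx0 hx1 (by norm_num) (by omega)
        h2 (Or.inl ⟨rfl, tauThree_one_le.trans (by positivity)⟩) A O hA hO hlo
    · refine ratio_of_local_optimum G w k _ 2 x _ hG hw hk hx0 hx1 (by ring) ?_
        h2 (Or.inr ⟨rfl, h.le.trans (min_le_left _ _)⟩) A O hA hO hlo
      have : 0 < k * (k - 1) := Nat.mul_pos (by omega) (by omega)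
      rw [mul_assoc]; omega

/-! ## Termination and feasibility of the local search -/

section Search
variable {V : Type*} {G : SimpleGraph V}

theorem nbhd_subset (G : SimpleGraph V) (C A : Finset V) : nbhd G C A ⊆ A :=
  fun _ hb => (mem_nbhd.1 hb).1

variable [DecidableEq V]

theorem sum_exchange {C S : Finset V} (hCS : Disjoint C S) (f : V → ℝ) :
    ∑ v ∈ (S ∪ C) \ nbhd G C S, f v + ∑ v ∈ nbhd G C S, f v = ∑ v ∈ S, f v + ∑ v ∈ C, f v := by
  rw [Finset.sum_sdiff ((nbhd_subset G C S).trans Finset.subset_union_left),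
    Finset.sum_union hCS.symm]

theorem isIndepSet_exchange {C S : Finset V} (hS : G.IsIndepSet (S : Set V))
    (hC : G.IsIndepSet (C : Set V)) : G.IsIndepSet (((S ∪ C) \ nbhd G C S : Finset V) : Set V) := by
  intro a ha b hb hab hadj
  obtain ⟨ha, ha'⟩ := Finset.mem_sdiff.1 (Finset.mem_coe.1 ha)
  obtain ⟨hb, hb'⟩ := Finset.mem_sdiff.1 (Finset.mem_coe.1 hb)
  rcases Finset.mem_union.1 ha with haS | haC <;> rcases Finset.mem_union.1 hb with hbS | hbC
  · exact hS haS hbS hab hadj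
  · exact ha' (mem_nbhd.2 ⟨haS, Or.inl ⟨b, hbC, hadj.symm⟩⟩)
  · exact hb' (mem_nbhd.2 ⟨hbS, Or.inl ⟨a, haC, hadj⟩⟩)
  · exact hC haC hbC hab hadj

theorem wellFounded_of_increasing {X R : Type*} [Finite X] [Preorder R] (f : X → R)
    (r : X → X → Prop) (h : ∀ a b, r a b → f a < f b) : WellFounded fun b a => r a b := by
  let r' : X → X → Prop := fun b a => f a < f b
  have : IsTrans X r' := ⟨fun _ _ _ h1 h2 => lt_trans (α := R) h2 h1⟩
  have : Std.Irrefl r' := ⟨fun _ h => lt_irrefl _ h⟩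
  exact Subrelation.wf (fun {b a} hr => h a b hr) (Finite.wellFounded_of_trans_of_irrefl r')

theorem exists_terminal {X : Type*} {r : X → X → Prop} (h : WellFounded fun b a => r a b) (a : X) :
    ∃ b, Relation.ReflTransGen r a b ∧ ∀ c, ¬ r b c := by
  induction a using h.induction with
  | _ a ih =>
    by_cases ha : ∃ b, r a b
    · obtain ⟨b, hb⟩ := ha
      obtain ⟨c, hc, hc'⟩ := ih b hb
      exact ⟨c, .head hb hc, hc'⟩
    · exact ⟨a, .refl, fun c hc => ha ⟨c, hc⟩⟩

/-- The squared weight increases strictly, and there are finitely many vertex sets. -/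
theorem wellFounded_improvement [Finite V] (G : SimpleGraph V) (w : V → ℝ) (r : ℕ) :
    WellFounded fun T S => Improvement G w r S T := by
  refine wellFounded_of_increasing (fun S : Finset V => ∑ v ∈ S, w v ^ 2) _ ?_
  rintro S T ⟨C, hCS, -, -, hlt, rfl⟩
  have := sum_exchange (G := G) hCS fun v => w v ^ 2
  linarith

theorem GreedyStep.isIndepSet {w : V → ℝ} {S T : Finset V} (h : GreedyStep G w S T)
    (hS : G.IsIndepSet (S : Set V)) : G.IsIndepSet (T : Set V) := by
  obtain ⟨v, hv, -, rfl⟩ := h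
  rw [Finset.coe_insert]
  refine Set.Pairwise.insert hS fun b hb _ => ⟨fun h => hv.2 b hb h.symm, hv.2 b hb⟩

theorem exists_greedyOutput [Fintype V] (G : SimpleGraph V) (w : V → ℝ) :
    ∃ S, IsGreedyOutput G w S := by
  classical
  have hwf : WellFounded fun T S => GreedyStep G w S T := by
    refine wellFounded_of_increasing Finset.card _ ?_
    rintro S T ⟨v, hv, -, rfl⟩
    rw [Finset.card_insert_of_notMem hv.1]
    exact Nat.lt_succ_self _
  obtain ⟨S, hS, hterm⟩ := exists_terminal hwf ∅
  refine ⟨S, hS, fun v hv => ?_⟩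
  obtain ⟨u, hu, hmax⟩ := (Finset.univ.filter (IsFree G S)).exists_max_image w
    ⟨v, by simpa using hv⟩
  exact hterm _ ⟨u, by simpa using hu, fun v hv => hmax v (by simpa using hv), rfl⟩

/-- Ensures that the guarantee for all outputs is not vacuous. -/
theorem exists_localSearchOutput [Fintype V] (G : SimpleGraph V) (w : V → ℝ) (r : ℕ) :
    ∃ A, IsLocalSearchOutput G w r A := by
  obtain ⟨S, hS⟩ := exists_greedyOutput G w
  obtain ⟨A, hA, hterm⟩ := exists_terminal (wellFounded_improvement G w r) S
  exact ⟨A, S, hS, hA, hterm⟩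

theorem IsLocalSearchOutput.isIndepSet {w : V → ℝ} {r : ℕ} {A : Finset V}
    (h : IsLocalSearchOutput G w r A) : G.IsIndepSet (A : Set V) := by
  obtain ⟨S, ⟨hS, -⟩, hA, -⟩ := h
  have h1 : G.IsIndepSet (S : Set V) := by
    clear hA
    induction hS with
    | refl => simp
    | tail _ h ih => exact h.isIndepSet ih
  induction hA with
  | refl => exact h1
  | tail _ h ih =>
    obtain ⟨C, -, -, hC, -, rfl⟩ := h
    exact isIndepSet_exchange ih hC

theorem IsLocalSearchOutput.ratio {w : V → ℝ} {k s : ℕ} {τ : ℝ} (hp : IsParam k s τ)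
    (hk : 1 ≤ k) (hG : IsClawFree G (k + 1)) (hw : ∀ v, 0 ≤ w v) {A : Finset V}
    (h : IsLocalSearchOutput G w (s * k) A) {O : Finset V} (hO : G.IsIndepSet (O : Set V)) :
    ∑ v ∈ O, w v ≤ (k + 1 - τ) / 2 * ∑ v ∈ A, w v := by
  have hA := h.isIndepSet
  obtain ⟨S, -, -, hterm⟩ := h
  refine hp.ratio hk hG hw hA hO fun C hC hCA hcard => ?_
  by_contra hcon
  exact hterm _ ⟨C, hCA, hcard, fun a ha b hb => hO (hC ha) (hC hb), not_le.1 hcon, rfl⟩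

end Search

/-! ## Conflict graphs -/

theorem isPacking_iff {ι U : Type*} (F : ι → Finset U) (P : Finset ι) :
    IsPacking F P ↔ (conflictGraph F).IsIndepSet (P : Set ι) := by
  refine ⟨fun h a ha b hb hab hadj => hadj.2 (h ha hb hab), fun h a ha b hb hab => ?_⟩
  by_contra hcon
  exact h ha hb hab ⟨hab, hcon⟩

/-- Each talon shares an element with the center, and these elements are distinct because the talons
are disjoint. -/
theorem isClawFree_conflictGraph {ι U : Type*} (F : ι → Finset U) (k : ℕ)
    (hF : ∀ i, (F i).card ≤ k) : IsClawFree (conflictGraph F) (k + 1) := by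
  classical
  rintro ⟨c, T, hT, hadj, hind⟩
  have h1 : ∀ t ∈ T, ∃ x ∈ F c, x ∈ F t := fun t ht => Finset.not_disjoint_iff.1 (hadj t ht).2
  rcases T.eq_empty_or_nonempty with rfl | ⟨t₀, ht₀⟩
  · simp at hT
  have : Nonempty U := ⟨(h1 t₀ ht₀).choose⟩
  choose! x hx hx' using h1
  have h2 : T.card ≤ (F c).card := Finset.card_le_card_of_injOn x hx fun a ha b hb hab => by
    by_contra hne
    refine hind ha hb hne ⟨hne, Finset.not_disjoint_iff.2 ⟨x a, hx' a ha, ?_⟩⟩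
    rw [hab]; exact hx' b hb
  have := hF c
  omega

/-! ## Hoare triples for step-counting programs -/

open Timed

/-- The computation halts after at most `T` steps, with a result that satisfies `Q`. -/
def Runs {α : Type} (x : Timed α) (T : ℕ) (Q : α → Prop) : Prop :=
  ∃ a t, x.HaltsWith a t ∧ t ≤ T ∧ Q a

namespace Runs
variable {α β : Type} {T T₁ T₂ : ℕ}

protected theorem pure {a : α} {Q : α → Prop} (h : Q a) : Runs (pure a) T Q :=
  ⟨a, 0, rfl, Nat.zero_le _, h⟩

protected theorem tick {c : ℕ} (h : c ≤ T) : Runs (tick c) T fun _ => True :=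
  ⟨(), c, rfl, h, trivial⟩

protected theorem bind {x : Timed α} {f : α → Timed β} {P : α → Prop} {Q : β → Prop}
    (hx : Runs x T₁ P) (hf : ∀ a, P a → Runs (f a) T₂ Q) (hT : T₁ + T₂ ≤ T) :
    Runs (x >>= f) T Q := by
  obtain ⟨a, t, rfl, ht, ha⟩ := hx
  obtain ⟨b, t', hb, ht', hQ⟩ := hf a ha
  refine ⟨b, t + t', ?_, by omega, hQ⟩
  change (match f a with
    | none => none
    | some (b, t') => some (b, t + t')) = _
  rw [show f a = some (b, t') from hb]

protected theorem mono {x : Timed α} {P Q : α → Prop} (hx : Runs x T₁ P) (hT : T₁ ≤ T)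
    (h : ∀ a, P a → Q a) : Runs x T Q := by
  obtain ⟨a, t, hxa, ht, ha⟩ := hx
  exact ⟨a, t, hxa, ht.trans hT, h a ha⟩

protected theorem ite {b : Bool} {x y : Timed α} {Q : α → Prop} (hx : b = true → Runs x T Q)
    (hy : b = false → Runs y T Q) : Runs (if b = true then x else y) T Q := by
  cases b
  · exact hy rfl
  · exact hx rfl

theorem anyM {p : α → Timed Bool} {P : α → Prop} {l : List α}
    (h : ∀ a ∈ l, Runs (p a) T fun b => b = true ↔ P a) :
    Runs (l.anyM p) (l.length * T) fun b => b = true ↔ ∃ a ∈ l, P a := by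
  induction l with
  | nil => exact .pure (by simp)
  | cons a l ih =>
    rw [List.anyM_cons]
    refine Runs.bind (T₂ := l.length * T) (h a (by simp)) (fun b hb => .ite (fun h' => .pure ?_)
      fun h' => (ih fun c hc => h c (by simp [hc])).mono le_rfl fun b' hb' => ?_) ?_
    · simp [hb.1 h']
    · have : ¬ P a := fun h2 => by simp [hb.2 h2] at h'
      simp [hb', this]
    · simp [add_mul, add_comm]

theorem allM {p : α → Timed Bool} {P : α → Prop} {l : List α}
    (h : ∀ a ∈ l, Runs (p a) T fun b => b = true ↔ P a) :
    Runs (l.allM p) (l.length * T) fun b => b = true ↔ ∀ a ∈ l, P a := by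
  induction l with
  | nil => exact .pure (by simp)
  | cons a l ih =>
    rw [List.allM_cons]
    refine Runs.bind (T₂ := l.length * T) (h a (by simp)) (fun b hb => .ite (fun h' =>
      (ih fun c hc => h c (by simp [hc])).mono le_rfl fun b' hb' => ?_) fun h' => .pure ?_) ?_
    · simp [hb', hb.1 h']
    · have : ¬ P a := fun h2 => by simp [hb.2 h2] at h'
      simp [this]
    · simp [add_mul, add_comm]

theorem findSomeM? {f : α → Timed (Option β)} {Q : α → Option β → Prop} {l : List α}
    (h : ∀ a ∈ l, Runs (f a) T (Q a)) :
    Runs (l.findSomeM? f) (l.length * T) fun o =>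
      (∃ a ∈ l, ∃ b, o = some b ∧ Q a (some b)) ∨ (o = none ∧ ∀ a ∈ l, Q a none) := by
  induction l with
  | nil => exact .pure (by simp)
  | cons a l ih =>
    rw [List.findSomeM?_cons]
    refine Runs.bind (T₂ := l.length * T) (h a (by simp)) (fun o ho => ?_)
      (by simp [add_mul, add_comm])
    match o, ho with
    | some b, ho => exact .pure (Or.inl ⟨a, by simp, b, rfl, ho⟩)
    | none, ho =>
      refine (ih fun c hc => h c (by simp [hc])).mono le_rfl fun o' ho' => ?_
      rcases ho' with ⟨c, hc, b, rfl, hb⟩ | ⟨rfl, hall⟩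
      · exact Or.inl ⟨c, by simp [hc], b, rfl, hb⟩
      · exact Or.inr ⟨rfl, by simpa using ⟨ho, hall⟩⟩

/-- The loop rule: the invariant `I` refers to the prefix that has been processed. -/
theorem foldlM {f : β → α → Timed β} {I : List α → β → Prop} {l : List α} {b₀ : β}
    (h0 : I [] b₀)
    (h : ∀ l₁ a l₂ b, l = l₁ ++ a :: l₂ → I l₁ b → Runs (f b a) T (I (l₁ ++ [a]))) :
    Runs (l.foldlM f b₀) (l.length * T) (I l) := by
  suffices H : ∀ l₂ l₁ b, l = l₁ ++ l₂ → I l₁ b →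
      Runs (l₂.foldlM f b) (l₂.length * T) (I l) from H l [] b₀ rfl h0
  intro l₂
  induction l₂ with
  | nil => intro l₁ b hl hI; exact .pure (by simpa [hl] using hI)
  | cons a l₂ ih =>
    intro l₁ b hl hI
    rw [List.foldlM_cons]
    exact .bind (h l₁ a l₂ b hl hI) (fun b' hb' => ih (l₁ ++ [a]) b' (by simp [hl]) hb')
      (by simp [add_mul, add_comm])

theorem filterC {test : α → Timed Bool} {P : α → Prop} {l : List α}
    (h : ∀ a ∈ l, Runs (test a) T fun b => b = true ↔ P a) :
    Runs (SquaredWeight.filterC test l) (l.length * (1 + T)) fun r =>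
      r.Sublist l ∧ ∀ a, a ∈ r ↔ a ∈ l ∧ P a := by
  induction l with
  | nil => exact .pure (by simp)
  | cons a l ih =>
    unfold SquaredWeight.filterC
    refine .bind (.tick le_rfl) (fun _ _ => .bind (h a (by simp)) (fun b hb =>
      .bind (ih fun c hc => h c (by simp [hc])) (fun r hr => .pure (T := 0) ?_) le_rfl) le_rfl) ?_
    · obtain ⟨hr, hr'⟩ := hr
      cases b
      · have : ¬ P a := fun h2 => Bool.false_ne_true (hb.2 h2)
        refine ⟨hr.cons a, fun c => ?_⟩
        simp only [Bool.false_eq_true, if_false, hr', List.mem_cons]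
        constructor
        · exact fun h => ⟨Or.inr h.1, h.2⟩
        · rintro ⟨rfl | h1, h2⟩
          · exact absurd h2 this
          · exact ⟨h1, h2⟩
      · refine ⟨hr.cons_cons a, fun c => ?_⟩
        have hPa := hb.1 rfl
        simp only [if_true, hr', List.mem_cons]
        constructor
        · rintro (rfl | h)
          · exact ⟨Or.inl rfl, hPa⟩
          · exact ⟨Or.inr h.1, h.2⟩
        · rintro ⟨rfl | h1, h2⟩
          · exact Or.inl rfl
          · exact Or.inr ⟨h1, h2⟩
    · simp only [List.length_cons, add_mul, one_mul]; omega

theorem tabulate {n : ℕ} {f : Fin n → Timed α} {P : Fin n → α → Prop}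
    (h : ∀ i, Runs (f i) T (P i)) :
    Runs (SquaredWeight.tabulate f) (n * (1 + n.size + T)) fun g => ∀ i, P i (g i) := by
  -- The recursion charges for the shrinking length; a fixed `M` makes the bound uniform.
  suffices H : ∀ M, n ≤ M → Runs (SquaredWeight.tabulate f) (n * (1 + M.size + T))
      fun g => ∀ i, P i (g i) from H n le_rfl
  induction n with
  | zero => intro M _; exact .pure fun i => i.elim0
  | succ n ih =>
    intro M hM
    unfold SquaredWeight.tabulate
    refine .bind (.tick (T := 1 + M.size) (by have := Nat.size_le_size hM; omega)) (fun _ _ =>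
      .bind (h 0) (fun a ha => .bind (ih (fun i => h i.succ) M (by omega)) (fun g hg =>
        .pure (T := 0) fun i => ?_) le_rfl) le_rfl) ?_
    · refine Fin.cases ?_ (fun i => ?_) i
      · simpa using ha
      · simpa using hg i
    · simp only [add_mul, one_mul]; omega

end Runs

/-! ## Primitive operations -/

/-- All primitive operations on vertices of `Fin n` and on numbers with at most `R` binary digits
take at most `B` steps. -/
structure Budget (n R B : ℕ) : Prop where
  arith : 1 + n.size + 2 * R ≤ B
  mul : (1 + R) * (1 + R) ≤ B

section Primitive
variable {n R B : ℕ} {a b : ℕ}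

theorem Budget.one_le (hB : Budget n R B) : 1 ≤ B := by have := hB.arith; omega

theorem Budget.addN (hB : Budget n R B) (ha : a.size ≤ R) (hb : b.size ≤ R) :
    Runs (addN a b) B (· = a + b) :=
  .bind (.tick le_rfl) (fun _ _ => .pure (T := 0) rfl) (by have := hB.arith; omega)

theorem Budget.ltN (hB : Budget n R B) (ha : a.size ≤ R) (hb : b.size ≤ R) :
    Runs (ltN a b) B fun c => c = true ↔ a < b :=
  .bind (.tick le_rfl) (fun _ _ => .pure (T := 0) (by simp)) (by have := hB.arith; omega)

theorem Budget.mulN (hB : Budget n R B) (ha : a.size ≤ R) (hb : b.size ≤ R) :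
    Runs (mulN a b) B (· = a * b) :=
  .bind (.tick le_rfl) (fun _ _ => .pure (T := 0) rfl)
    ((Nat.mul_le_mul (by omega) (by omega)).trans hB.mul)

theorem Budget.divN (hB : Budget n R B) (ha : a.size ≤ R) (hb : b.size ≤ R) :
    Runs (divN a b) B (· = a / b) :=
  .bind (.tick le_rfl) (fun _ _ => .pure (T := 0) rfl)
    ((Nat.mul_le_mul (by omega) (by omega)).trans hB.mul)

theorem Budget.sameVertex (hB : Budget n R B) (u v : Fin n) :
    Runs (sameVertex u v) B fun c => c = true ↔ u = v :=
  .bind (.tick le_rfl) (fun _ _ => .pure (T := 0) (by simp)) (by have := hB.arith; omega)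

theorem Budget.readBit (hB : Budget n R B) (S : Fin n → Bool) (v : Fin n) :
    Runs (readBit S v) B (· = S v) :=
  .bind (.tick le_rfl) (fun _ _ => .pure (T := 0) rfl) (by have := hB.arith; omega)

theorem Budget.readN (hB : Budget n R B) (w : Fin n → ℕ) (v : Fin n) (hv : (w v).size ≤ R) :
    Runs (readN w v) B (· = w v) :=
  .bind (.tick le_rfl) (fun _ _ => .pure (T := 0) rfl) (by have := hB.arith; omega)

theorem Budget.tabulate (hB : Budget n R B) {α : Type} {T : ℕ} {f : Fin n → Timed α}
    {P : Fin n → α → Prop} (h : ∀ i, Runs (f i) T (P i)) :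
    Runs (tabulate f) (n * (B + T)) fun g => ∀ i, P i (g i) :=
  (Runs.tabulate h).mono (Nat.mul_le_mul_left _ (by have := hB.arith; omega)) fun _ => id

theorem Budget.filterC (hB : Budget n R B) {α : Type} {T : ℕ} {test : α → Timed Bool}
    {P : α → Prop} {l : List α} (h : ∀ a ∈ l, Runs (test a) T fun b => b = true ↔ P a) :
    Runs (filterC test l) (l.length * (B + T)) fun r => r.Sublist l ∧ ∀ a, a ∈ r ↔ a ∈ l ∧ P a :=
  (Runs.filterC h).mono (Nat.mul_le_mul_left _ (by have := hB.one_le; omega)) fun _ => id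

theorem Budget.emptyC (hB : Budget n R B) :
    Runs (emptyC n) (n * B) fun S => ∀ v, S v = false :=
  hB.tabulate (T := 0) (P := fun _ b => b = false) fun _ => .pure rfl

end Primitive

/-- The program `adj` decides adjacency in `G` within `B` steps. -/
def Decides {n : ℕ} (adj : Fin n → Fin n → Timed Bool) (G : SimpleGraph (Fin n)) (B : ℕ) : Prop :=
  ∀ u v, Runs (adj u v) B fun b => b = true ↔ G.Adj u v

@[simp] theorem mem_toSet {n : ℕ} {S : Fin n → Bool} {v : Fin n} : v ∈ toSet S ↔ S v = true := by
  simp [toSet]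

/-! ## The local search program -/

section Program
variable {n R B : ℕ} {G : SimpleGraph (Fin n)} {adj : Fin n → Fin n → Timed Bool}

theorem conflicts_runs (hB : Budget n R B) (hadj : Decides adj G B) (u : Fin n)
    (C : List (Fin n)) : Runs (conflicts adj u C) (C.length * (2 * B))
      fun b => b = true ↔ ∃ c ∈ C, u = c ∨ G.Adj u c := by
  unfold conflicts
  refine Runs.anyM fun c _ => .bind (T₂ := B) (hB.sameVertex u c) (fun b hb =>
    .ite (fun h => .pure ?_) fun h => (hadj u c).mono le_rfl fun b' hb' => ?_) (by omega)
  · simp [hb.1 h]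
  · have : u ≠ c := fun h2 => by simp [hb.2 h2] at h
    simp [hb', this]

theorem independentC_runs (hB : Budget n R B) (hadj : Decides adj G B) (C : List (Fin n)) :
    Runs (independentC adj C) ((C.length + 1) * (B + C.length * (2 * B)))
      fun b => b = true ↔ C.Pairwise fun c d => ¬ (c = d ∨ G.Adj c d) := by
  suffices H : ∀ m, C.length ≤ m → Runs (independentC adj C)
      ((C.length + 1) * (B + m * (2 * B)))
      fun b => b = true ↔ C.Pairwise fun c d => ¬ (c = d ∨ G.Adj c d) from H _ le_rfl
  induction C with
  | nil =>
    intro m _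
    refine .bind (.tick hB.one_le) (fun _ _ => .pure (T := 0) (by simp)) ?_
    simp
  | cons c C ih =>
    intro m hm
    have hlen : C.length ≤ m := by simp at hm; omega
    unfold independentC
    refine .bind (T₂ := m * (2 * B) + (C.length + 1) * (B + m * (2 * B))) (.tick hB.one_le)
      (fun _ _ => .bind (T₂ := (C.length + 1) * (B + m * (2 * B)))
      ((conflicts_runs hB hadj c C).mono (Nat.mul_le_mul_right _ hlen) fun _ => id)
      (fun b hb => .ite (fun h => .pure ?_) fun h => (ih m hlen).mono le_rfl fun b' hb' => ?_)
      le_rfl) ?_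
    · obtain ⟨d, hd, hcd⟩ := hb.1 h
      simp only [Bool.false_eq_true, List.pairwise_cons, false_iff]
      exact fun h2 => h2.1 d hd hcd
    · have : ¬ ∃ d ∈ C, c = d ∨ G.Adj c d := fun h2 => by simp [hb.2 h2] at h
      rw [hb', List.pairwise_cons]
      exact ⟨fun h2 => ⟨fun d hd hcd => this ⟨d, hd, hcd⟩, h2⟩, fun h2 => h2.2⟩
    · simp only [List.length_cons, add_mul, one_mul]; omega

/-- All partial sums and squares are at most `L M²`, so `hR` bounds the digits of every number that
occurs. -/
theorem sqWeight_runs (hB : Budget n R B) (w : Fin n → ℕ) (C : List (Fin n)) (L M : ℕ)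
    (hL : C.length ≤ L) (hM : ∀ v ∈ C, w v ≤ M) (hR : ∀ a ≤ L * M ^ 2, a.size ≤ R) :
    Runs (sqWeight w C) (C.length * (3 * B)) (· = (C.map fun v => w v ^ 2).sum) := by
  unfold sqWeight
  refine Runs.foldlM (I := fun l acc => acc = (l.map fun v => w v ^ 2).sum) (by simp) ?_
  rintro l₁ v l₂ _ rfl rfl
  have hlen : l₁.length + 1 ≤ L := by simp at hL; omega
  have hv : w v ^ 2 ≤ M ^ 2 := Nat.pow_le_pow_left (hM v (by simp)) 2
  have hsum : (l₁.map fun v => w v ^ 2).sum ≤ l₁.length * M ^ 2 := by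
    have := List.sum_le_card_nsmul (l₁.map fun v => w v ^ 2) (M ^ 2) (by
      intro x hx
      obtain ⟨u, hu, rfl⟩ := List.mem_map.1 hx
      exact Nat.pow_le_pow_left (hM u (by simp [hu])) 2)
    simpa using this
  have h1 : 1 * M ^ 2 ≤ L * M ^ 2 := Nat.mul_le_mul_right _ (by omega)
  have h2 : l₁.length * M ^ 2 ≤ L * M ^ 2 := Nat.mul_le_mul_right _ (by omega)
  have h3 : w v ≤ w v ^ 2 := Nat.le_self_pow (by norm_num) _
  refine .bind (T₂ := 2 * B) (hB.readN w v (hR _ (by omega))) ?_ (by omega)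
  rintro _ rfl
  refine .bind (T₂ := B) (hB.mulN (hR _ (by omega)) (hR _ (by omega))) ?_ (by omega)
  rintro _ rfl
  refine (hB.addN (hR _ (by omega)) (hR _ (by rw [← sq]; omega))).mono le_rfl ?_
  rintro _ rfl
  simp [sq]

/-- `C` lists the vertices of an improvement of `S` among the live vertices. -/
def IsImprovingList (G : SimpleGraph (Fin n)) (alive : Fin n → Bool) (w : Fin n → ℕ)
    (S : Fin n → Bool) (C : List (Fin n)) : Prop :=
  (∀ c ∈ C, alive c = true ∧ S c = false) ∧ C.Pairwise (fun c d => ¬ (c = d ∨ G.Adj c d)) ∧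
    ∑ v ∈ nbhd G C.toFinset (toSet S), w v ^ 2 < ∑ v ∈ C.toFinset, w v ^ 2

/-- The number of primitive operations in the test of an exchange with at most `m` vertices. -/
def testCost (n m : ℕ) : ℕ := 2 * m + (m + 1) * (1 + 2 * m) + n * (2 + 2 * m) + 3 * n + 3 * m + 1

theorem isImprovement_runs (hB : Budget n R B) (hadj : Decides adj G B)
    (alive : Fin n → Bool) (w : Fin n → ℕ) (S : Fin n → Bool) (C : List (Fin n)) (m M : ℕ)
    (hS : ∀ v, S v = true → alive v = true) (hC : C.length ≤ m)
    (hM : ∀ v, alive v = true → w v ≤ M) (hR : ∀ a ≤ (n + m) * M ^ 2, a.size ≤ R) :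
    Runs (isImprovement adj alive w S C) (B * testCost n m)
      fun b => b = true ↔ IsImprovingList G alive w S C := by
  unfold isImprovement
  have h1 : Runs (C.allM fun c => do
      let a ← readBit alive c
      let b ← readBit S c
      pure (a && !b)) (m * (2 * B)) fun b => b = true ↔ ∀ c ∈ C, alive c = true ∧ S c = false := by
    refine (Runs.allM (T := 2 * B) (P := fun c => alive c = true ∧ S c = false)
      fun c _ => ?_).mono (Nat.mul_le_mul_right _ hC) fun _ => id
    refine .bind (T₂ := B) (hB.readBit alive c) ?_ (by omega)
    rintro _ rfl
    refine .bind (T₂ := 0) (hB.readBit S c) ?_ (by omega)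
    rintro _ rfl
    exact .pure (by simp)
  have h2 := (independentC_runs hB hadj C).mono (Q := fun b => b = true ↔ _)
    (Nat.mul_le_mul (Nat.add_le_add_right hC 1)
      (Nat.add_le_add_left (Nat.mul_le_mul_right (2 * B) hC) B)) fun _ => id
  have h3 : Runs (filterC (fun u => do
      if ← readBit S u then conflicts adj u C else pure false) (List.finRange n))
      (n * (B + (B + m * (2 * B)))) fun N => N.Sublist (List.finRange n) ∧
        ∀ u, u ∈ N ↔ u ∈ List.finRange n ∧ S u = true ∧ ∃ c ∈ C, u = c ∨ G.Adj u c := by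
    have := hB.filterC (l := List.finRange n) (T := B + m * (2 * B))
      (P := fun u => S u = true ∧ ∃ c ∈ C, u = c ∨ G.Adj u c) (test := fun u => do
      if ← readBit S u then conflicts adj u C else pure false) fun u _ => by
        refine .bind (T₂ := m * (2 * B)) (hB.readBit S u) ?_ le_rfl
        rintro _ rfl
        refine .ite (fun h => ((conflicts_runs hB hadj u C).mono
          (Nat.mul_le_mul_right _ hC) fun b hb => ?_)) fun h => .pure (by simp [h])
        rw [hb]; simp [h]
    rwa [List.length_finRange] at this
  refine .bind (T₂ := (m + 1) * (B + m * (2 * B)) + (n * (B + (B + m * (2 * B))) +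
    (n * (3 * B) + (m * (3 * B) + B)))) h1 (fun outside hout => .bind h2 (fun indep hind =>
      .ite (fun h => ?_) fun h => .pure ?_) le_rfl) ?_
  · rw [Bool.and_eq_true] at h
    have hCa := hout.1 h.1
    have hCi := hind.1 h.2
    refine .bind h3 ?_ le_rfl
    rintro N ⟨hNsub, hN⟩
    have hNnd : N.Nodup := hNsub.nodup (List.nodup_finRange n)
    have hNlen : N.length ≤ n := by simpa using hNsub.length_le
    have hNset : N.toFinset = nbhd G C.toFinset (toSet S) := by
      ext u
      rw [List.mem_toFinset, hN, mem_nbhd]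
      simp only [List.mem_finRange, true_and, mem_toSet, List.mem_toFinset, and_congr_right_iff]
      intro _
      constructor
      · rintro ⟨c, hc, rfl | hadj⟩
        · exact Or.inr hc
        · exact Or.inl ⟨c, hc, hadj.symm⟩
      · rintro (⟨c, hc, hadj⟩ | hu)
        · exact ⟨c, hc, Or.inr hadj.symm⟩
        · exact ⟨u, hu, Or.inl rfl⟩
    have hCnd : C.Nodup := hCi.imp fun h h' => h (Or.inl h')
    have hsumle : ∀ l : List (Fin n), l.length ≤ n + m → (∀ v ∈ l, w v ≤ M) →
        (l.map fun v => w v ^ 2).sum ≤ (n + m) * M ^ 2 := fun l hl hlM => by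
      have := List.sum_le_card_nsmul (l.map fun v => w v ^ 2) (M ^ 2) (by
        intro x hx
        obtain ⟨u, hu, rfl⟩ := List.mem_map.1 hx
        exact Nat.pow_le_pow_left (hlM u hu) 2)
      rw [List.length_map, smul_eq_mul] at this
      exact this.trans (Nat.mul_le_mul_right _ hl)
    have hNM : ∀ v ∈ N, w v ≤ M := fun v hv => hM v (hS v ((hN v).1 hv).2.1)
    have hCM : ∀ v ∈ C, w v ≤ M := fun v hv => hM v (hCa v hv).1
    refine .bind (T₁ := n * (3 * B)) ((sqWeight_runs hB w N (n + m) M (by omega) hNM hR).mono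
      (Nat.mul_le_mul_right _ hNlen) fun _ => id) ?_ le_rfl
    rintro _ rfl
    refine .bind (T₁ := m * (3 * B)) ((sqWeight_runs hB w C (n + m) M (by omega) hCM hR).mono
      (Nat.mul_le_mul_right _ hC) fun _ => id) ?_ le_rfl
    rintro _ rfl
    refine (hB.ltN (hR _ (hsumle N (by omega) hNM)) (hR _ (hsumle C (by omega) hCM))).mono
      le_rfl fun b hb => ?_
    rw [hb, ← List.sum_toFinset _ hNnd, ← List.sum_toFinset _ hCnd, hNset]
    exact ⟨fun h => ⟨hCa, hCi, h⟩, fun h => h.2.2⟩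
  · simp only [Bool.false_eq_true, false_iff]
    rintro ⟨h4, h5, -⟩
    simp [hout.2 h4, hind.2 h5] at h
  · apply le_of_eq; unfold testCost; ring

/-- The enumeration prepends vertices one at a time, so the extensions of `C` by the list `D` appear
as `D.reverse ++ C`. Failure certifies that none of them is an improvement. -/
theorem findImprovement_runs (hB : Budget n R B) (hadj : Decides adj G B)
    (alive : Fin n → Bool) (w : Fin n → ℕ) (S : Fin n → Bool) (m M : ℕ)
    (hS : ∀ v, S v = true → alive v = true)
    (hM : ∀ v, alive v = true → w v ≤ M) (hR : ∀ a ≤ (n + m) * M ^ 2, a.size ≤ R)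
    (r : ℕ) (C : List (Fin n)) (hC : C.length + r ≤ m) :
    Runs (findImprovement adj alive w S r C) ((n + 1) ^ r * (B * testCost n m))
      fun o => (∃ C', o = some C' ∧ C'.length ≤ C.length + r ∧ IsImprovingList G alive w S C') ∨
        (o = none ∧ ∀ D : List (Fin n), D.length ≤ r →
          ¬ IsImprovingList G alive w S (D.reverse ++ C)) := by
  induction r generalizing C with
  | zero =>
    unfold findImprovement
    refine .bind (T₂ := 0) (isImprovement_runs hB hadj alive w S C m M hS (by omega) hM hR)
      (fun b hb => .ite (fun h => .pure (Or.inl ⟨C, rfl, by omega, hb.1 h⟩)) fun h => .pure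
        (Or.inr ⟨rfl, fun D hD hD' => ?_⟩)) (by simp)
    rw [List.eq_nil_of_length_eq_zero (Nat.le_zero.1 hD)] at hD'
    simp [hb.2 hD'] at h
  | succ r ih =>
    unfold findImprovement
    refine .bind (T₂ := n * ((n + 1) ^ r * (B * testCost n m)))
      (isImprovement_runs hB hadj alive w S C m M hS (by omega) hM hR)
      (fun b hb => .ite (fun h => .pure (Or.inl ⟨C, rfl, by omega, hb.1 h⟩)) fun h => ?_) ?_
    · have := Runs.findSomeM? (l := List.finRange n) fun v _ =>
        ih (v :: C) (by simp only [List.length_cons]; omega)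
      rw [List.length_finRange] at this
      refine this.mono le_rfl ?_
      rintro o (⟨v, -, C', rfl, ⟨C'', hC'', hlen, himp⟩ | ⟨h, -⟩⟩ | ⟨rfl, hall⟩)
      · obtain rfl := Option.some_injective _ hC''
        exact Or.inl ⟨C', rfl, by simp only [List.length_cons] at hlen; omega, himp⟩
      · cases h
      · refine Or.inr ⟨rfl, fun D hD himp => ?_⟩
        cases D with
        | nil => simp [hb.2 (by simpa using himp)] at h
        | cons v D =>
          rcases hall v (List.mem_finRange v) with ⟨_, h2, -⟩ | ⟨-, h2⟩
          · cases h2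
          · exact h2 D (by simpa using hD) (by simpa using himp)
    · have h1 : 1 ≤ (n + 1) ^ r := Nat.one_le_pow _ _ (by omega)
      calc B * testCost n m + n * ((n + 1) ^ r * (B * testCost n m))
          ≤ (n + 1) ^ r * (B * testCost n m) + n * ((n + 1) ^ r * (B * testCost n m)) :=
            Nat.add_le_add_right (Nat.le_mul_of_pos_left _ h1) _
        _ = _ := by ring

theorem exchange_runs (hB : Budget n R B) (hadj : Decides adj G B) (S : Fin n → Bool)
    (C : List (Fin n)) (m : ℕ) (hC : C.length ≤ m) (hCS : ∀ c ∈ C, S c = false) :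
    Runs (exchange adj S C) (B * (n * (2 + 3 * m))) fun S' =>
      toSet S' = (toSet S ∪ C.toFinset) \ nbhd G C.toFinset (toSet S) := by
  unfold exchange
  refine (hB.tabulate (T := m * B + (B + m * (2 * B))) (P := fun u b => b = true ↔
    u ∈ (toSet S ∪ C.toFinset) \ nbhd G C.toFinset (toSet S)) fun u => ?_).mono
    (le_of_eq (by ring)) fun S' hS' => ?_
  · refine .bind (T₁ := m * B) ((Runs.anyM fun c _ => hB.sameVertex u c).mono
      (Nat.mul_le_mul_right _ hC) fun _ => id) (fun b hb => .ite (fun h => .pure ?_) fun h => ?_)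
      le_rfl
    · obtain ⟨c, hc, rfl⟩ := hb.1 h
      simp [mem_nbhd, hc, hCS u hc]
    · have huC : u ∉ C := fun h2 => by simp [hb.2 ⟨u, h2, rfl⟩] at h
      refine .bind (T₁ := B) (hB.readBit S u) ?_ le_rfl
      rintro _ rfl
      refine .ite (fun h2 => .bind (T₂ := 0) ((conflicts_runs hB hadj u C).mono
        (Nat.mul_le_mul_right _ hC) fun _ => id) (fun b' hb' => .pure ?_) le_rfl)
        fun h2 => .pure (by simp [huC, h2])
      rw [Bool.not_eq_true', ← Bool.not_eq_true, hb']
      simp only [Finset.mem_sdiff, Finset.mem_union, mem_toSet, h2, mem_nbhd, List.mem_toFinset,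
        huC, true_and, or_false, not_iff_not]
      constructor
      · rintro ⟨c, hc, rfl | h3⟩
        · exact absurd hc huC
        · exact ⟨c, hc, h3.symm⟩
      · rintro ⟨c, hc, h3⟩
        exact ⟨c, hc, Or.inr h3.symm⟩
  · ext u
    rw [mem_toSet, hS']

/-- One round of the local search program. -/
def SearchStep (G : SimpleGraph (Fin n)) (alive : Fin n → Bool) (w : Fin n → ℕ) (r : ℕ)
    (S S' : Fin n → Bool) : Prop :=
  ∃ C : List (Fin n), C.length ≤ r ∧ IsImprovingList G alive w S C ∧
    toSet S' = (toSet S ∪ C.toFinset) \ nbhd G C.toFinset (toSet S)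

theorem SearchStep.alive {alive : Fin n → Bool} {w : Fin n → ℕ} {r : ℕ} {S S' : Fin n → Bool}
    (h : SearchStep G alive w r S S') (hS : ∀ v, S v = true → alive v = true) :
    ∀ v, S' v = true → alive v = true := by
  obtain ⟨C, -, ⟨hC, -⟩, hS'⟩ := h
  intro v hv
  rw [← mem_toSet, hS', Finset.mem_sdiff, Finset.mem_union, mem_toSet, List.mem_toFinset] at hv
  exact hv.1.elim (hS v) fun h => (hC v h).1

theorem IsImprovingList.disjoint {alive : Fin n → Bool} {w : Fin n → ℕ} {S : Fin n → Bool}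
    {C : List (Fin n)} (h : IsImprovingList G alive w S C) : Disjoint C.toFinset (toSet S) := by
  rw [Finset.disjoint_left]
  intro v hv hvS
  have := (h.1 v (List.mem_toFinset.1 hv)).2
  rw [mem_toSet, this] at hvS
  exact absurd hvS Bool.false_ne_true

theorem IsImprovingList.isIndepSet {alive : Fin n → Bool} {w : Fin n → ℕ} {S : Fin n → Bool}
    {C : List (Fin n)} (h : IsImprovingList G alive w S C) :
    G.IsIndepSet (C.toFinset : Set (Fin n)) := by
  intro a ha b hb hab hadj
  have hsymm : ∀ ⦃c d⦄, ¬ (c = d ∨ G.Adj c d) → ¬ (d = c ∨ G.Adj d c) :=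
    fun c d h h' => h (h'.imp Eq.symm SimpleGraph.Adj.symm)
  have : Std.Symm fun c d => ¬ (c = d ∨ G.Adj c d) := ⟨hsymm⟩
  exact h.2.1.forall (by simpa using ha) (by simpa using hb) hab (Or.inr hadj)

theorem SearchStep.isIndepSet {alive : Fin n → Bool} {w : Fin n → ℕ} {r : ℕ} {S S' : Fin n → Bool}
    (h : SearchStep G alive w r S S') (hS : G.IsIndepSet (toSet S : Set (Fin n))) :
    G.IsIndepSet (toSet S' : Set (Fin n)) := by
  obtain ⟨C, -, hC, hS'⟩ := h
  rw [hS']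
  exact isIndepSet_exchange hS hC.isIndepSet

theorem SearchStep.sum_lt {alive : Fin n → Bool} {w : Fin n → ℕ} {r : ℕ} {S S' : Fin n → Bool}
    (h : SearchStep G alive w r S S') : ∑ v ∈ toSet S, w v ^ 2 < ∑ v ∈ toSet S', w v ^ 2 := by
  obtain ⟨C, -, hC, hS'⟩ := h
  have h1 := Finset.sum_sdiff (f := fun v => w v ^ 2)
    ((nbhd_subset G C.toFinset (toSet S)).trans (Finset.subset_union_left (s₂ := C.toFinset)))
  rw [Finset.sum_union hC.disjoint.symm] at h1
  have h2 := hC.2.2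
  rw [hS']
  omega

/-- The number of primitive operations in a round of the local search. -/
def roundCost (n m : ℕ) : ℕ := 1 + (n + 1) ^ m * testCost n m + n * (2 + 3 * m)

/-- Weights are integers, so every round raises the squared weight of `S` by at least one, and it
never exceeds `n M²`. The hypothesis `hfuel` is this potential argument, and it is preserved by a
round. -/
theorem localSearch_runs (hB : Budget n R B) (hadj : Decides adj G B)
    (alive : Fin n → Bool) (w : Fin n → ℕ) (m M : ℕ)
    (hM : ∀ v, alive v = true → w v ≤ M) (hR : ∀ a ≤ (n + m) * M ^ 2, a.size ≤ R)
    (fuel : ℕ) (S : Fin n → Bool) (hS : ∀ v, S v = true → alive v = true)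
    (hfuel : n * M ^ 2 < fuel + ∑ v ∈ toSet S, w v ^ 2) :
    Runs (localSearch adj alive w m fuel S) (fuel * (B * roundCost n m)) fun A =>
      Relation.ReflTransGen (SearchStep G alive w m) S A ∧
        ∀ C : List (Fin n), C.length ≤ m → ¬ IsImprovingList G alive w A C := by
  induction fuel generalizing S with
  | zero =>
    -- Fuel cannot run out: `hfuel` would contradict the bound on the squared weight.
    have : ∑ v ∈ toSet S, w v ^ 2 ≤ (toSet S).card * M ^ 2 :=
      Finset.sum_le_card_nsmul _ _ _ fun v hv =>
        Nat.pow_le_pow_left (hM v (hS v (mem_toSet.1 hv))) 2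
    have h2 : (toSet S).card * M ^ 2 ≤ n * M ^ 2 := Nat.mul_le_mul_right _ (card_finset_fin_le _)
    omega
  | succ fuel ih =>
    unfold localSearch
    refine .bind (T₁ := B) (T₂ := (n + 1) ^ m * (B * testCost n m) + (B * (n * (2 + 3 * m)) +
      fuel * (B * roundCost n m))) (.tick hB.one_le) (fun _ _ => .bind
      (findImprovement_runs hB hadj alive w S m M hS hM hR m [] (by simp)) ?_ le_rfl) ?_
    · rintro o (⟨C, rfl, hlen, himp⟩ | ⟨rfl, hall⟩)
      · rw [List.length_nil, zero_add] at hlen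
        refine .bind (exchange_runs hB hadj S C m hlen fun c hc => (himp.1 c hc).2)
          (fun S' hS' => ?_) le_rfl
        have hstep : SearchStep G alive w m S S' := ⟨C, hlen, himp, hS'⟩
        have := hstep.sum_lt
        exact (ih S' (hstep.alive hS) (by omega)).mono le_rfl fun A hA =>
          ⟨.head hstep hA.1, hA.2⟩
      · refine .pure ⟨.refl, fun C hC himp => hall C.reverse (by simpa using hC) ?_⟩
        simpa using himp
    · apply le_of_eq; unfold roundCost; ring

end Program

/-! ## The greedy program -/

section Program
variable {n R B : ℕ} {G : SimpleGraph (Fin n)} {adj : Fin n → Fin n → Timed Bool}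

/-- A live vertex that is neither in `S` nor adjacent to a member of `S`. -/
def IsLiveFree (G : SimpleGraph (Fin n)) (alive S : Fin n → Bool) (v : Fin n) : Prop :=
  alive v = true ∧ ¬ ∃ c, S c = true ∧ (v = c ∨ G.Adj v c)

theorem heaviestFree_runs (hB : Budget n R B) (hadj : Decides adj G B) (alive : Fin n → Bool)
    (w : Fin n → ℕ) (hw : ∀ v, (w v).size ≤ R) (S : Fin n → Bool) :
    Runs (heaviestFree adj alive w S) (B * (2 * n + n * (4 + 2 * n))) fun o =>
      (o = none ∧ ∀ v, ¬ IsLiveFree G alive S v) ∨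
        ∃ v, o = some v ∧ IsLiveFree G alive S v ∧ ∀ u, IsLiveFree G alive S u → w u ≤ w v := by
  unfold heaviestFree
  have h1 := hB.filterC (T := B) (P := fun u => S u = true) (l := List.finRange n)
    (test := fun u => readBit S u) fun u _ =>
      (hB.readBit S u).mono le_rfl fun b hb => by rw [hb]
  rw [List.length_finRange] at h1
  refine .bind (T₂ := n * (B + (n * (2 * B) + 3 * B))) h1 ?_ (le_of_eq (by ring))
  rintro members ⟨hsub, hmem⟩
  have hlen : members.length ≤ n := by simpa using hsub.length_le
  have h2 := Runs.foldlM (T := B + (n * (2 * B) + 3 * B))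
    (I := fun l (o : Option (Fin n)) => (o = none ∧ ∀ v ∈ l, ¬ IsLiveFree G alive S v) ∨
      ∃ v, o = some v ∧ IsLiveFree G alive S v ∧ ∀ u ∈ l, IsLiveFree G alive S u → w u ≤ w v)
    (l := List.finRange n) (b₀ := none) (f := fun best v => do
      let a ← readBit alive v
      let c ← conflicts adj v members
      if a && !c then
        match best with
        | none => pure (some v)
        | some b =>
          let x ← readN w b
          let y ← readN w v
          if ← ltN x y then pure (some v) else pure (some b)
      else pure best) (by simp) ?_
  · rw [List.length_finRange] at h2
    exact h2.mono le_rfl fun o ho => by simpa using ho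
  intro l₁ v l₂ o _ ho
  refine .bind (hB.readBit alive v) ?_ le_rfl
  rintro _ rfl
  refine .bind (T₂ := 3 * B) ((conflicts_runs hB hadj v members).mono
    (Nat.mul_le_mul_right _ hlen) fun _ => id) (fun c hc => ?_) le_rfl
  have hfree : (alive v && !c) = true ↔ IsLiveFree G alive S v := by
    rw [Bool.and_eq_true, Bool.not_eq_true', ← Bool.not_eq_true, hc]
    simp [IsLiveFree, hmem]
  refine .ite (fun h => ?_) fun h => .pure ?_
  · rw [hfree] at h
    rcases ho with ⟨rfl, hall⟩ | ⟨b, rfl, hbf, hbmax⟩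
    · refine .pure (Or.inr ⟨v, rfl, h, fun u hu huf => ?_⟩)
      rcases List.mem_append.1 hu with hu | hu
      · exact absurd huf (hall u hu)
      · rw [List.mem_singleton.1 hu]
    · refine .bind (T₂ := 2 * B) (hB.readN w b (hw b)) ?_ (by omega)
      rintro _ rfl
      refine .bind (T₂ := B) (hB.readN w v (hw v)) ?_ (by omega)
      rintro _ rfl
      refine .bind (T₂ := 0) (hB.ltN (hw b) (hw v)) (fun c hc => .ite (fun hlt => .pure ?_)
        fun hlt => .pure ?_) (by omega)
      · refine Or.inr ⟨v, rfl, h, fun u hu huf => ?_⟩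
        rcases List.mem_append.1 hu with hu | hu
        · exact (hbmax u hu huf).trans (hc.1 hlt).le
        · rw [List.mem_singleton.1 hu]
      · refine Or.inr ⟨b, rfl, hbf, fun u hu huf => ?_⟩
        rcases List.mem_append.1 hu with hu | hu
        · exact hbmax u hu huf
        · rw [List.mem_singleton.1 hu]
          by_contra hcon
          rw [hc.2 (not_le.1 hcon)] at hlt
          cases hlt
  · have h' : ¬ IsLiveFree G alive S v := fun h2 => by rw [hfree.2 h2] at h; cases h
    rcases ho with ⟨rfl, hall⟩ | ⟨b, rfl, hbf, hbmax⟩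
    · refine Or.inl ⟨rfl, fun u hu => ?_⟩
      rcases List.mem_append.1 hu with hu | hu
      · exact hall u hu
      · rwa [List.mem_singleton.1 hu]
    · refine Or.inr ⟨b, rfl, hbf, fun u hu huf => ?_⟩
      rcases List.mem_append.1 hu with hu | hu
      · exact hbmax u hu huf
      · rw [List.mem_singleton.1 hu] at huf
        exact absurd huf h'

/-- `v` is equal or adjacent to a member of `S` that is at least as heavy. -/
def IsDominated (G : SimpleGraph (Fin n)) (w : Fin n → ℕ) (S : Fin n → Bool) (v : Fin n) : Prop :=
  ∃ b, S b = true ∧ (v = b ∨ G.Adj v b) ∧ w v ≤ w b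

/-- The properties of greedy solutions among the live vertices. -/
structure IsGreedySolution (G : SimpleGraph (Fin n)) (alive : Fin n → Bool) (w : Fin n → ℕ)
    (S : Fin n → Bool) : Prop where
  indep : G.IsIndepSet (toSet S : Set (Fin n))
  live : ∀ v, S v = true → alive v = true
  dominated : ∀ v, alive v = true → IsDominated G w S v

/-- The number of primitive operations of the greedy algorithm. -/
def greedyCost (n : ℕ) : ℕ := n * (1 + (2 * n + n * (4 + 2 * n)) + 3 * n)

/-- Invariant `hSd`: a live vertex that is no longer free was blocked by a vertex that was a
heaviest free one at that moment, hence is dominated. `hm` says that `m` steps suffice, as each adds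
a vertex. -/
theorem greedyFrom_runs (hB : Budget n R B) (hadj : Decides adj G B) (alive : Fin n → Bool)
    (w : Fin n → ℕ) (hw : ∀ v, (w v).size ≤ R) (m : ℕ) (S : Fin n → Bool)
    (hSi : G.IsIndepSet (toSet S : Set (Fin n))) (hSa : ∀ v, S v = true → alive v = true)
    (hSd : ∀ v, alive v = true → IsLiveFree G alive S v ∨ IsDominated G w S v)
    (hm : n ≤ m + (toSet S).card) :
    Runs (greedyFrom adj alive w m S) (m * (B * (1 + (2 * n + n * (4 + 2 * n)) + 3 * n)))
      (IsGreedySolution G alive w) := by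
  induction m generalizing S with
  | zero =>
    have huniv : toSet S = Finset.univ :=
      (Finset.card_eq_iff_eq_univ _).1 (le_antisymm (Finset.card_le_univ _) (by simpa using hm))
    refine .pure ⟨hSi, hSa, fun v hv => ((hSd v hv).resolve_left fun h => h.2 ⟨v, ?_, Or.inl rfl⟩)⟩
    rw [← mem_toSet, huniv]; exact Finset.mem_univ v
  | succ m ih =>
    unfold greedyFrom
    refine .bind (T₁ := B) (T₂ := B * (2 * n + n * (4 + 2 * n)) + (n * (B + (B + B)) +
      m * (B * (1 + (2 * n + n * (4 + 2 * n)) + 3 * n)))) (.tick hB.one_le) (fun _ _ =>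
      .bind (heaviestFree_runs hB hadj alive w hw S) ?_ le_rfl) (le_of_eq (by ring))
    rintro o (⟨rfl, hall⟩ | ⟨v, rfl, hv, hvmax⟩)
    · exact .pure ⟨hSi, hSa, fun v hv => (hSd v hv).resolve_left (hall v)⟩
    · refine .bind (hB.tabulate (T := B + B) (P := fun u b => b = true ↔ u = v ∨ S u = true)
        fun u => .bind (T₂ := B) (hB.sameVertex u v) (fun b hb => .ite
          (fun h => .pure (by simp [hb.1 h])) fun h => (hB.readBit S u).mono le_rfl ?_) le_rfl)
        (fun S' hS' => ?_) le_rfl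
      · rintro _ rfl
        have : u ≠ v := fun h2 => by rw [hb.2 h2] at h; cases h
        simp [this]
      · have hset : toSet S' = insert v (toSet S) := by
          ext u; simp [hS']
        have hvS : v ∉ toSet S := fun h => hv.2 ⟨v, mem_toSet.1 h, Or.inl rfl⟩
        refine ih S' ?_ (fun u hu => ?_) (fun u hu => ?_) ?_
        · rw [hset, Finset.coe_insert]
          refine Set.Pairwise.insert hSi fun b hb _ => ?_
          have hb' := mem_toSet.1 (Finset.mem_coe.1 hb)
          exact ⟨fun h => hv.2 ⟨b, hb', Or.inr h⟩, fun h => hv.2 ⟨b, hb', Or.inr h.symm⟩⟩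
        · rcases (hS' u).1 hu with rfl | h
          · exact hv.1
          · exact hSa u h
        · rcases hSd u hu with hfree | ⟨b, hb, h1, h2⟩
          · by_cases huv : u = v ∨ G.Adj u v
            · exact Or.inr ⟨v, (hS' v).2 (Or.inl rfl), huv, hvmax u hfree⟩
            · refine Or.inl ⟨hu, ?_⟩
              rintro ⟨c, hc, hcu⟩
              rcases (hS' c).1 hc with rfl | h
              · exact huv hcu
              · exact hfree.2 ⟨c, h, hcu⟩
          · exact Or.inr ⟨b, (hS' b).2 (Or.inr hb), h1, h2⟩
        · rw [hset, Finset.card_insert_of_notMem hvS]; omega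

theorem weightC_runs (hB : Budget n R B) (w : Fin n → ℕ) (hw : (∑ v, w v).size ≤ R)
    (S : Fin n → Bool) :
    Runs (weightC w S) (B * (3 * n)) (· = ∑ v ∈ toSet S, w v) := by
  have hR : ∀ a ≤ ∑ v, w v, a.size ≤ R := fun a ha => (Nat.size_le_size ha).trans hw
  set f : Fin n → ℕ := fun v => if S v = true then w v else 0 with hf
  have hle : ∑ v, f v ≤ ∑ v, w v := Finset.sum_le_sum fun v _ => by
    simp only [hf]; split_ifs <;> omega
  have h := Runs.foldlM (T := 3 * B) (I := fun l acc => acc = (l.map f).sum)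
    (l := List.finRange n) (b₀ := 0) (f := fun acc v => do
      if ← readBit S v then
        let x ← readN w v
        addN acc x
      else pure acc) (by simp) (by
      rintro l₁ v l₂ _ hl rfl
      refine .bind (T₂ := 2 * B) (hB.readBit S v) ?_ (by omega)
      rintro _ rfl
      refine .ite (fun hv => ?_) fun hv => .pure (by simp [hf, hv])
      have hv' : w v ≤ ∑ v, w v := Finset.single_le_sum (fun _ _ => Nat.zero_le _)
        (Finset.mem_univ v)
      refine .bind (T₂ := B) (hB.readN w v (hR _ hv')) ?_ (by omega)
      rintro _ rfl
      refine (hB.addN (hR _ (le_trans ?_ hle)) (hR _ hv')).mono le_rfl ?_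
      · rw [Fin.sum_univ_def, hl, List.map_append, List.sum_append]
        exact Nat.le_add_right _ _
      · rintro _ rfl
        simp [hf, hv])
  rw [List.length_finRange] at h
  refine Runs.mono h (le_of_eq (by ring)) ?_
  rintro _ rfl
  rw [← Fin.sum_univ_def, toSet, Finset.sum_filter]

/-! ## Rescaling and partial enumeration -/

/-- The rescaled weights `⌊6 n² w_v / w(S₀)⌋`. -/
def scaledWeight (w : Fin n → ℕ) (S₀ : Fin n → Bool) (v : Fin n) : ℕ :=
  6 * (n * n) * w v / ∑ u ∈ toSet S₀, w u

/-- Results of the local search with rescaled weights. -/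
def IsScaledOutput (G : SimpleGraph (Fin n)) (alive : Fin n → Bool) (w : Fin n → ℕ) (r : ℕ)
    (A : Fin n → Bool) : Prop :=
  ∃ S₀, IsGreedySolution G alive w S₀ ∧
    Relation.ReflTransGen (SearchStep G alive (scaledWeight w S₀) r) S₀ A ∧
    ∀ C : List (Fin n), C.length ≤ r → ¬ IsImprovingList G alive (scaledWeight w S₀) A C

theorem IsGreedySolution.le_sum {alive : Fin n → Bool} {w : Fin n → ℕ} {S : Fin n → Bool}
    (h : IsGreedySolution G alive w S) (v : Fin n) (hv : alive v = true) :
    w v ≤ ∑ u ∈ toSet S, w u := by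
  obtain ⟨b, hb, -, hle⟩ := h.dominated v hv
  exact hle.trans (Finset.single_le_sum (fun _ _ => Nat.zero_le _) (mem_toSet.2 hb))

theorem IsScaledOutput.alive {alive : Fin n → Bool} {w : Fin n → ℕ} {r : ℕ} {A : Fin n → Bool}
    (h : IsScaledOutput G alive w r A) : ∀ v, A v = true → alive v = true := by
  obtain ⟨S₀, hS₀, hA, -⟩ := h
  induction hA with
  | refl => exact hS₀.live
  | tail _ h ih => exact h.alive ih

theorem IsScaledOutput.isIndepSet {alive : Fin n → Bool} {w : Fin n → ℕ} {r : ℕ} {A : Fin n → Bool}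
    (h : IsScaledOutput G alive w r A) : G.IsIndepSet (toSet A : Set (Fin n)) := by
  obtain ⟨S₀, hS₀, hA, -⟩ := h
  induction hA with
  | refl => exact hS₀.indep
  | tail _ h ih => exact h.isIndepSet ih

/-- All numbers that occur in the computations with rescaled weights have at most `R` digits. -/
structure FitsScaled (n m R : ℕ) (w : Fin n → ℕ) : Prop where
  const : 6 ≤ R
  dim : (6 * (n * n)).size ≤ R
  weight : (∑ v, w v).size ≤ R
  scaled : (6 * (n * n) * ∑ v, w v).size ≤ R
  square : ((n + m) * (6 * (n * n)) ^ 2).size ≤ R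

/-- A bound for the number of rounds of the local search with rescaled weights. -/
def roundBound (n : ℕ) : ℕ := n * (6 * (n * n)) ^ 2 + 1

/-- The number of primitive operations of the local search with rescaled weights. -/
def scaledCost (n m : ℕ) : ℕ := n + greedyCost n + 3 * n + 2 + 4 * n + roundBound n * roundCost n m

theorem scaledLocalSearch_runs (hB : Budget n R B) (hadj : Decides adj G B) (alive : Fin n → Bool)
    (w : Fin n → ℕ) (m : ℕ) (hR : FitsScaled n m R w) :
    Runs (scaledLocalSearch adj alive w m (roundBound n)) (B * scaledCost n m)
      (IsScaledOutput G alive w m) := by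
  have hwle : ∀ v, w v ≤ ∑ v, w v := fun v =>
    Finset.single_le_sum (fun _ _ => Nat.zero_le _) (Finset.mem_univ v)
  have hw : ∀ v, (w v).size ≤ R := fun v => (Nat.size_le_size (hwle v)).trans hR.weight
  have hnn : n ≤ 6 * (n * n) := by nlinarith
  unfold scaledLocalSearch
  refine .bind (T₂ := B * greedyCost n + (B * (3 * n) + (B + (B + (n * (B + 3 * B) +
    roundBound n * (B * roundCost n m)))))) hB.emptyC (fun E hE => .bind
    (T₁ := B * greedyCost n) ((greedyFrom_runs hB hadj alive w hw n E ?_ ?_ ?_ (by omega)).mono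
      (le_of_eq (by unfold greedyCost; ring)) fun _ => id) (fun S₀ hS₀ => ?_) le_rfl)
    (le_of_eq (by unfold scaledCost; ring))
  · intro a ha
    simp [hE] at ha
  · intro v hv
    simp [hE] at hv
  · intro v hv
    exact Or.inl ⟨hv, by simp [hE]⟩
  · refine .bind (weightC_runs hB w hR.weight S₀) ?_ le_rfl
    rintro _ rfl
    refine .bind (hB.mulN ((Nat.size_le_size hnn).trans hR.dim)
      ((Nat.size_le_size hnn).trans hR.dim)) ?_ le_rfl
    rintro _ rfl
    refine .bind (hB.mulN ((show Nat.size 6 ≤ 6 by decide).trans hR.const)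
      ((Nat.size_le_size (Nat.le_mul_of_pos_left _ (by norm_num))).trans hR.dim)) ?_ le_rfl
    rintro _ rfl
    refine .bind (hB.tabulate (T := 3 * B) (P := fun v y => y = scaledWeight w S₀ v) fun v => ?_)
      (fun w' hw' => ?_) le_rfl
    · refine .bind (T₂ := 2 * B) (hB.readN w v (hw v)) ?_ (by omega)
      rintro _ rfl
      refine .bind (T₂ := B) (hB.mulN hR.dim (hw v)) ?_ (by omega)
      rintro _ rfl
      exact hB.divN ((Nat.size_le_size (Nat.mul_le_mul_left _ (hwle v))).trans hR.scaled)
        ((Nat.size_le_size (Finset.sum_le_univ_sum_of_nonneg fun _ => Nat.zero_le _)).trans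
          hR.weight)
    · obtain rfl : w' = scaledWeight w S₀ := funext hw'
      -- Domination gives `w v ≤ w(S₀)` for live `v`, so rescaled weights are at most `6n²` and the
      -- number of rounds depends on `n` alone.
      refine (localSearch_runs hB hadj alive (scaledWeight w S₀) m (6 * (n * n)) (fun v hv => ?_)
        (fun a ha => (Nat.size_le_size ha).trans hR.square) (roundBound n) S₀ hS₀.live
        (by unfold roundBound; omega)).mono le_rfl fun A hA => ⟨S₀, hS₀, hA⟩
      refine Nat.div_le_of_le_mul ?_
      rw [mul_comm]
      exact Nat.mul_le_mul_right _ (hS₀.le_sum v hv)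

/-- The live vertices after `v` and its neighbours have been deleted. -/
def IsResidual (G : SimpleGraph (Fin n)) (v : Fin n) (alive : Fin n → Bool) : Prop :=
  ∀ u, alive u = true ↔ ¬ (u = v ∨ G.Adj u v)

/-- `A` is at least as good as the candidate that is computed for the vertex `v`. -/
def BeatsCandidate (G : SimpleGraph (Fin n)) (w : Fin n → ℕ) (r : ℕ) (A : Fin n → Bool)
    (v : Fin n) : Prop :=
  ∃ alive A', IsResidual G v alive ∧ IsScaledOutput G alive w r A' ∧
    w v + ∑ u ∈ toSet A', w u ≤ ∑ u ∈ toSet A, w u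

/-- The number of primitive operations of the algorithm for integral weights. -/
def approxIntCost (n m : ℕ) : ℕ := n + n * (3 * n + scaledCost n m + 3 * n + 6 * n + 1)

theorem approxInt_runs (hB : Budget n R B) (hadj : Decides adj G B)
    (w : Fin n → ℕ) (m : ℕ) (hR : FitsScaled n m R w) :
    Runs (approxInt adj w m (roundBound n)) (B * approxIntCost n m) fun A =>
      G.IsIndepSet (toSet A : Set (Fin n)) ∧ ∀ v, BeatsCandidate G w m A v := by
  unfold approxInt
  refine .bind (T₂ := n * (B * (3 * n + scaledCost n m + 3 * n + 6 * n + 1))) hB.emptyC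
    (fun E hE => ?_) (le_of_eq (by unfold approxIntCost; ring))
  have h := Runs.foldlM (T := B * (3 * n + scaledCost n m + 3 * n + 6 * n + 1))
    (I := fun l A => G.IsIndepSet (toSet A : Set (Fin n)) ∧ ∀ v ∈ l, BeatsCandidate G w m A v)
    (l := List.finRange n) (b₀ := E) (f := fun best v => do
      let alive ← tabulate fun u => do
        let b ← conflicts adj u [v]
        pure (!b)
      let A' ← scaledLocalSearch adj alive w m (roundBound n)
      let A ← tabulate fun u => do
        if ← sameVertex u v then pure true else readBit A' u
      let x ← weightC w best
      let y ← weightC w A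
      if ← ltN x y then pure A else pure best) ?_ ?_
  · rw [List.length_finRange] at h
    exact h.mono le_rfl fun A hA => ⟨hA.1, fun v => hA.2 v (List.mem_finRange v)⟩
  · refine ⟨fun a ha => ?_, by simp⟩
    simp [hE] at ha
  · rintro l₁ v l₂ best - ⟨hbest, hbeats⟩
    refine .bind (T₂ := B * scaledCost n m + (n * (B + 2 * B) + (B * (3 * n) + (B * (3 * n) + B))))
      (hB.tabulate (T := 2 * B) (P := fun u b => b = true ↔ ¬ (u = v ∨ G.Adj u v)) fun u =>
      .bind (T₂ := 0) (conflicts_runs hB hadj u [v]) (fun b hb => .pure ?_) (by simp))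
      (fun alive halive => ?_) (le_of_eq (by ring))
    · rw [Bool.not_eq_true', ← Bool.not_eq_true, hb]
      simp
    refine .bind (scaledLocalSearch_runs hB hadj alive w m hR) (fun A' hA' => ?_) le_rfl
    refine .bind (hB.tabulate (T := 2 * B) (P := fun u b => b = true ↔ u = v ∨ A' u = true)
        fun u => .bind (T₂ := B) (hB.sameVertex u v) (fun b hb => .ite
          (fun h => .pure (by simp [hb.1 h])) fun h => (hB.readBit A' u).mono le_rfl ?_) (by omega))
        (fun A hA => ?_) le_rfl
    · rintro _ rfl
      have : u ≠ v := fun h2 => by rw [hb.2 h2] at h; cases h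
      simp [this]
    have hset : toSet A = insert v (toSet A') := by ext u; simp [hA]
    have hvA' : v ∉ toSet A' := fun h =>
      (halive v).1 (hA'.alive v (mem_toSet.1 h)) (Or.inl rfl)
    have hsum : ∑ u ∈ toSet A, w u = w v + ∑ u ∈ toSet A', w u := by
      rw [hset, Finset.sum_insert hvA']
    have hAind : G.IsIndepSet (toSet A : Set (Fin n)) := by
      rw [hset, Finset.coe_insert]
      refine Set.Pairwise.insert hA'.isIndepSet fun b hb _ => ?_
      have hb' := (halive b).1 (hA'.alive b (mem_toSet.1 (Finset.mem_coe.1 hb)))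
      exact ⟨fun h => hb' (Or.inr h.symm), fun h => hb' (Or.inr h)⟩
    refine .bind (weightC_runs hB w hR.weight best) ?_ le_rfl
    rintro _ rfl
    refine .bind (weightC_runs hB w hR.weight A) ?_ le_rfl
    rintro _ rfl
    have hsz : ∀ S : Finset (Fin n), (∑ u ∈ S, w u).size ≤ R := fun S =>
      (Nat.size_le_size (Finset.sum_le_univ_sum_of_nonneg fun _ => Nat.zero_le _)).trans hR.weight
    refine .bind (T₂ := 0) (hB.ltN (hsz _) (hsz _)) (fun b hb => .ite (fun h => .pure ?_)
      fun h => .pure ?_) le_rfl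
    · have hlt := hb.1 h
      refine ⟨hAind, fun u hu => ?_⟩
      rcases List.mem_append.1 hu with hu | hu
      · obtain ⟨al, A'', h1, h2, h3⟩ := hbeats u hu
        exact ⟨al, A'', h1, h2, h3.trans hlt.le⟩
      · rw [List.mem_singleton.1 hu]
        exact ⟨alive, A', halive, hA', hsum.ge⟩
    · have hle : ∑ u ∈ toSet A, w u ≤ ∑ u ∈ toSet best, w u := by
        by_contra hcon
        rw [hb.2 (not_le.1 hcon)] at h
        cases h
      refine ⟨hbest, fun u hu => ?_⟩
      rcases List.mem_append.1 hu with hu | hu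
      · exact hbeats u hu
      · rw [List.mem_singleton.1 hu]
        exact ⟨alive, A', halive, hA', hsum.ge.trans hle⟩

/-! ## The approximation factor with rescaled weights -/

theorem sum_sq_le_of_not_improvingList {alive : Fin n → Bool} {w : Fin n → ℕ} {r : ℕ}
    {A : Fin n → Bool}
    (h : ∀ C : List (Fin n), C.length ≤ r → ¬ IsImprovingList G alive w A C)
    {C : Finset (Fin n)} (hC : ∀ v ∈ C, alive v = true) (hCi : G.IsIndepSet (C : Set (Fin n)))
    (hCA : Disjoint C (toSet A)) (hcard : C.card ≤ r) :
    ∑ v ∈ C, (w v : ℝ) ^ 2 ≤ ∑ v ∈ nbhd G C (toSet A), (w v : ℝ) ^ 2 := by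
  have h1 := h C.toList (by simpa using hcard)
  by_contra hcon
  refine h1 ⟨fun c hc => ?_, ?_, ?_⟩
  · rw [Finset.mem_toList] at hc
    refine ⟨hC c hc, ?_⟩
    have := Finset.disjoint_left.1 hCA hc
    rwa [mem_toSet, Bool.not_eq_true] at this
  · refine C.nodup_toList.imp_of_mem fun {a b} ha hb hab h => ?_
    rw [Finset.mem_toList] at ha hb
    exact h.elim hab (hCi ha hb hab)
  · rw [Finset.toList_toFinset]
    exact_mod_cast not_le.1 hcon

/-- The candidate that matters belongs to a heaviest vertex `v` of an optimum `P`. In its residual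
instance, `P` without `v` is feasible; rounding loses at most `w v / 6` there, which is recovered
because `v` itself is counted with factor `1` instead of `α`. -/
theorem ratio_of_beatsCandidate {k s : ℕ} {τ : ℝ} (hp : IsParam k s τ)
    (hk : 1 ≤ k) (hG : IsClawFree G (k + 1)) (w : Fin n → ℕ) (A : Fin n → Bool)
    (hA : ∀ v, BeatsCandidate G w (s * k) A v) (O : Finset (Fin n))
    (hO : G.IsIndepSet (O : Set (Fin n))) :
    ∑ v ∈ O, (w v : ℝ) ≤ (k + 1 - τ) / 2 * ∑ v ∈ toSet A, (w v : ℝ) := by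
  classical
  set α : ℝ := (k + 1 - τ) / 2 with hα
  have hτ := hp.le_two_thirds
  have hk' : (1 : ℝ) ≤ k := by exact_mod_cast hk
  obtain ⟨P, hP, hPmax⟩ := (Finset.univ.filter fun P : Finset (Fin n) =>
    G.IsIndepSet (P : Set (Fin n))).exists_max_image (fun P => ∑ v ∈ P, w v) ⟨O, by simpa using hO⟩
  have hPi : G.IsIndepSet (P : Set (Fin n)) := (Finset.mem_filter.1 hP).2
  have hPmax : ∀ Q : Finset (Fin n), G.IsIndepSet (Q : Set (Fin n)) →
      ∑ v ∈ Q, w v ≤ ∑ v ∈ P, w v := fun Q hQ => hPmax Q (by simpa using hQ)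
  suffices H : ∑ v ∈ P, (w v : ℝ) ≤ α * ∑ v ∈ toSet A, (w v : ℝ) from
    le_trans (by exact_mod_cast hPmax O hO) H
  rcases P.eq_empty_or_nonempty with rfl | hne
  · rw [Finset.sum_empty]
    exact mul_nonneg (by rw [hα]; linarith) (Finset.sum_nonneg fun _ _ => Nat.cast_nonneg _)
  obtain ⟨v, hv, hvmax⟩ := P.exists_max_image w hne
  obtain ⟨alive, A', halive, ⟨S₀, hS₀, hreach, hterm⟩, hle⟩ := hA v
  have hout : IsScaledOutput G alive w (s * k) A' := ⟨S₀, hS₀, hreach, hterm⟩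
  set P' := P.erase v with hP'
  have hP'i : G.IsIndepSet (P' : Set (Fin n)) := fun a ha b hb =>
    hPi (Finset.mem_of_mem_erase ha) (Finset.mem_of_mem_erase hb)
  have hP'a : ∀ u ∈ P', alive u = true := fun u hu => by
    obtain ⟨huv, huP⟩ := Finset.mem_erase.1 hu
    exact (halive u).2 fun h => h.elim huv (hPi huP hv huv)
  have hsplit : ∑ u ∈ P, (w u : ℝ) = w v + ∑ u ∈ P', (w u : ℝ) :=
    (Finset.add_sum_erase P (fun u => (w u : ℝ)) hv).symm
  have hle' : (w v : ℝ) + ∑ u ∈ toSet A', (w u : ℝ) ≤ ∑ u ∈ toSet A, (w u : ℝ) := by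
    exact_mod_cast hle
  set W := ∑ u ∈ toSet S₀, w u with hW
  have hv0 : (0 : ℝ) ≤ w v := Nat.cast_nonneg _
  have hA'0 : (0 : ℝ) ≤ ∑ u ∈ toSet A', (w u : ℝ) :=
    Finset.sum_nonneg fun _ _ => Nat.cast_nonneg _
  rcases hk.eq_or_lt with rfl | hk2
  · obtain ⟨rfl, hτ0⟩ := hp.one
    -- For `k = 1` nothing better than `α ≥ 1` is available, which leaves no room for a rounding
    -- loss.
    have hα1 : 1 ≤ α := by rw [hα]; push_cast; linarith
    -- greedy solutions are local optima for exchanges of single vertices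
    have hdom : ∀ w' : Fin n → ℕ, (∀ u b, w u ≤ w b → w' u ≤ w' b) → ∀ C : Finset (Fin n),
        (∀ u ∈ C, alive u = true) → Disjoint C (toSet S₀) → C.card ≤ 1 →
        ∑ u ∈ C, w' u ^ 2 ≤ ∑ u ∈ nbhd G C (toSet S₀), w' u ^ 2 := by
      intro w' hw' C hCa hCS hcard
      rcases Nat.le_one_iff_eq_zero_or_eq_one.1 hcard with h0 | h1
      · rw [Finset.card_eq_zero.1 h0, Finset.sum_empty]
        exact Nat.zero_le _
      · obtain ⟨c, rfl⟩ := Finset.card_eq_one.1 h1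
        obtain ⟨b, hb, hcb, hwb⟩ := hS₀.dominated c (hCa c (by simp))
        have hne : c ≠ b := fun h => Finset.disjoint_left.1 hCS (Finset.mem_singleton_self c)
          (mem_toSet.2 (h ▸ hb))
        rw [Finset.sum_singleton]
        refine (Nat.pow_le_pow_left (hw' c b hwb) 2).trans ?_
        exact Finset.single_le_sum (f := fun u => w' u ^ 2) (fun _ _ => Nat.zero_le _)
          (mem_nbhd.2 ⟨mem_toSet.2 hb, Or.inl ⟨c, by simp, hcb.resolve_left hne⟩⟩)
    -- Rescaling preserves the order of the weights, so the search stops at the greedy solution, and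
    -- the ratio can be proved with the original weights.
    have hA'S : A' = S₀ := by
      rcases Relation.ReflTransGen.cases_head hreach with h | ⟨S', ⟨C, hlen, himp, -⟩, -⟩
      · exact h.symm
      · refine absurd himp.2.2 (not_lt.2 (hdom _ (fun u b hub => ?_) _ (fun u hu =>
          (himp.1 u (List.mem_toFinset.1 hu)).1) himp.disjoint
          ((List.toFinset_card_le C).trans hlen)))
        exact Nat.div_le_div_right (Nat.mul_le_mul_left _ hub)
    have hgreedy : ∑ u ∈ P', (w u : ℝ) ≤ α * ∑ u ∈ toSet S₀, (w u : ℝ) :=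
      hp.ratio (w := fun u => (w u : ℝ)) le_rfl hG (fun _ => Nat.cast_nonneg _) hS₀.indep
      hP'i fun C hC hCS hcard => by
        exact_mod_cast hdom w (fun _ _ => id) C (fun u hu => hP'a u (hC hu)) hCS hcard
    rw [hA'S] at hle'
    rw [hsplit]
    have h2 := mul_le_mul_of_nonneg_left hle' (by linarith : 0 ≤ α)
    have h3 := mul_le_mul_of_nonneg_right hα1 hv0
    rw [mul_add] at h2
    linarith
  have hk2' : (2 : ℝ) ≤ k := by exact_mod_cast hk2
  -- From `k ≥ 2` and `τ ≤ 2/3`; the excess `1/6` matches the constant `6` in the scaling factor.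
  have hα7 : 7 / 6 ≤ α := by rw [hα]; linarith
  have hfin : ∑ u ∈ P', (w u : ℝ) ≤ α * ∑ u ∈ toSet A', (w u : ℝ) + w v / 6 := by
    have hn : (0 : ℝ) < n := by exact_mod_cast (Fin.pos v)
    rcases Nat.eq_zero_or_pos W with h0 | hpos
    · rw [Finset.sum_eq_zero fun u hu => by
        have := hS₀.le_sum u (hP'a u hu)
        rw [← hW, h0, Nat.le_zero] at this
        exact_mod_cast this]
      exact add_nonneg (mul_nonneg (by linarith) hA'0) (by positivity)
    have hlocal := hp.ratio (w := fun u => (scaledWeight w S₀ u : ℝ)) hk hG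
      (fun _ => Nat.cast_nonneg _) hout.isIndepSet hP'i fun C hC hCA hcard =>
        sum_sq_le_of_not_improvingList hterm (fun u hu => hP'a u (hC hu))
          (fun a ha b hb => hP'i (hC ha) (hC hb)) hCA hcard
    have hlow : ∀ u, (W : ℝ) * scaledWeight w S₀ u ≤ 6 * (n * n) * w u := fun u => by
      exact_mod_cast Nat.mul_div_le _ _
    have hhigh : ∀ u, 6 * (n * n) * (w u : ℝ) ≤ W * scaledWeight w S₀ u + W := fun u => by
      have := (Nat.lt_mul_div_succ (6 * (n * n) * w u) hpos).le
      rw [mul_add, mul_one] at this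
      exact_mod_cast this
    have h1 : 6 * (n * n) * ∑ u ∈ P', (w u : ℝ) ≤
        W * ∑ u ∈ P', (scaledWeight w S₀ u : ℝ) + n * W := by
      rw [Finset.mul_sum, Finset.mul_sum]
      refine (Finset.sum_le_sum fun u _ => hhigh u).trans ?_
      rw [Finset.sum_add_distrib, Finset.sum_const, nsmul_eq_mul]
      gcongr
      exact card_finset_fin_le P'
    have h2 : W * ∑ u ∈ toSet A', (scaledWeight w S₀ u : ℝ) ≤
        6 * (n * n) * ∑ u ∈ toSet A', (w u : ℝ) := by
      rw [Finset.mul_sum, Finset.mul_sum]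
      exact Finset.sum_le_sum fun u _ => hlow u
    -- `S₀` together with `v` is feasible, so it weighs at most `w(P) ≤ n w v`. Rounding at most `n`
    -- weights, each by at most `W / (6n²)`, then costs at most `w v / 6`.
    have hWn : (W : ℝ) ≤ n * w v := by
      have hvS : v ∉ toSet S₀ := fun h => (halive v).1 (hS₀.live v (mem_toSet.1 h)) (Or.inl rfl)
      have h3 := hPmax (insert v (toSet S₀)) (by
        rw [Finset.coe_insert]
        refine Set.Pairwise.insert hS₀.indep fun b hb _ => ?_
        have hb' := (halive b).1 (hS₀.live b (mem_toSet.1 (Finset.mem_coe.1 hb)))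
        exact ⟨fun h => hb' (Or.inr h.symm), fun h => hb' (Or.inr h)⟩)
      rw [Finset.sum_insert hvS] at h3
      have h4 : ∑ u ∈ P, w u ≤ n * w v := by
        refine (Finset.sum_le_card_nsmul P w (w v) hvmax).trans ?_
        rw [smul_eq_mul]
        exact Nat.mul_le_mul_right _ (card_finset_fin_le P)
      have h5 : W ≤ n * w v := by omega
      exact_mod_cast h5
    have h3 : (W : ℝ) * ∑ u ∈ P', (scaledWeight w S₀ u : ℝ) ≤
        α * (W * ∑ u ∈ toSet A', (scaledWeight w S₀ u : ℝ)) := by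
      rw [mul_left_comm]
      exact mul_le_mul_of_nonneg_left hlocal (Nat.cast_nonneg _)
    have h4 := mul_le_mul_of_nonneg_left h2 (by linarith : 0 ≤ α)
    have h5 := mul_le_mul_of_nonneg_left hWn hn.le
    refine le_of_mul_le_mul_left (a := 6 * ((n : ℝ) * n)) ?_ (by positivity)
    linarith
  rw [hsplit]
  have h2 := mul_le_mul_of_nonneg_left hle' (by linarith : 0 ≤ α)
  have h3 := mul_le_mul_of_nonneg_right hα7 hv0
  rw [mul_add] at h2
  linarith

end Program

/-! ## Rational weights -/

/-- The integral weights computed by `clearDenominators`. -/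
def clearedWeight {n : ℕ} (w : Fin n → ℚ≥0) (v : Fin n) : ℕ :=
  (w v).num * ((∏ u, (w u).den) / (w v).den)

theorem cast_clearedWeight {n : ℕ} (w : Fin n → ℚ≥0) (v : Fin n) :
    (clearedWeight w v : ℝ) = ((∏ u, (w u).den : ℕ) : ℝ) * (w v : ℝ) := by
  have hne : ((w v).den : ℝ) ≠ 0 := by exact_mod_cast (w v).den_ne_zero
  rw [clearedWeight, Nat.cast_mul, Nat.cast_div (Finset.dvd_prod_of_mem _ (Finset.mem_univ v)) hne,
    NNRat.cast_def (w v)]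
  ring

/-- Clearing denominators multiplies all weights by the same positive number. -/
theorem sum_le_of_clearedWeight {n : ℕ} (w : Fin n → ℚ≥0) (O A : Finset (Fin n)) (α : ℝ)
    (h : ∑ v ∈ O, (clearedWeight w v : ℝ) ≤ α * ∑ v ∈ A, (clearedWeight w v : ℝ)) :
    ∑ v ∈ O, (w v : ℝ) ≤ α * ∑ v ∈ A, (w v : ℝ) := by
  have hD : (0 : ℝ) < ((∏ u, (w u).den : ℕ) : ℝ) := by
    exact_mod_cast Finset.prod_pos fun u _ => (w u).den_pos
  simp only [cast_clearedWeight, ← Finset.mul_sum] at h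
  rw [mul_left_comm] at h
  exact le_of_mul_le_mul_left h hD

section Program
variable {n R B : ℕ} {G : SimpleGraph (Fin n)} {adj : Fin n → Fin n → Timed Bool}

theorem clearDenominators_runs (hB : Budget n R B) (w : Fin n → ℚ≥0)
    (hden : (∏ u, (w u).den).size ≤ R) (hnum : ∀ v, (w v).num.size ≤ R) :
    Runs (clearDenominators w) (B * (7 * n)) (· = clearedWeight w) := by
  have hpos : 0 < ∏ u, (w u).den := Finset.prod_pos fun u _ => (w u).den_pos
  have hden' : ∀ v, (w v).den.size ≤ R := fun v => (Nat.size_le_size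
    (Nat.le_of_dvd hpos (Finset.dvd_prod_of_mem _ (Finset.mem_univ v)))).trans hden
  unfold clearDenominators
  have h := Runs.foldlM (T := 2 * B) (l := List.finRange n) (b₀ := 1)
    (I := fun l acc => acc = (l.map fun u => (w u).den).prod) (f := fun acc v => do
      let q ← readN (fun u => (w u).den) v
      mulN acc q) (by simp) (by
    rintro l₁ v l₂ _ hl rfl
    refine .bind (T₂ := B) (hB.readN (fun u => (w u).den) v (hden' v)) ?_ (by omega)
    rintro _ rfl
    refine (hB.mulN ((Nat.size_le_size (Nat.le_of_dvd hpos ?_)).trans hden) (hden' v)).mono le_rfl ?_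
    · rw [Fin.prod_univ_def, hl, List.map_append, List.prod_append]
      exact Dvd.intro _ rfl
    · rintro _ rfl
      simp)
  rw [List.length_finRange] at h
  refine .bind (T₂ := n * (B + 4 * B)) h ?_ (le_of_eq (by ring))
  rintro _ rfl
  rw [← Fin.prod_univ_def]
  refine (hB.tabulate (T := 4 * B) (P := fun v x => x = clearedWeight w v) fun v => ?_).mono
    le_rfl fun g hg => funext hg
  refine .bind (T₂ := 3 * B) (hB.readN (fun u => (w u).num) v (hnum v)) ?_ (by omega)
  rintro _ rfl
  refine .bind (T₂ := 2 * B) (hB.readN (fun u => (w u).den) v (hden' v)) ?_ (by omega)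
  rintro _ rfl
  refine .bind (T₂ := B) (hB.divN hden (hden' v)) ?_ (by omega)
  rintro _ rfl
  exact hB.mulN (hnum v) ((Nat.size_le_size (Nat.div_le_self _ _)).trans hden)

/-! ### Digit counts and the total cost -/

theorem size_le_of_le_two_pow {a b : ℕ} (h : a ≤ 2 ^ b) : a.size ≤ b + 1 :=
  Nat.size_le.2 (h.trans_lt (Nat.pow_lt_pow_right (by norm_num) (Nat.lt_succ_self b)))

theorem size_le_self (a : ℕ) : a.size ≤ a := Nat.size_le.2 Nat.lt_two_pow_self

theorem size_mul_le (a b : ℕ) : (a * b).size ≤ a.size + b.size := by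
  rw [Nat.size_le, pow_add]
  exact Nat.mul_lt_mul'' (Nat.lt_size_self a) (Nat.lt_size_self b)

/-- A bound for the number of binary digits of all numbers in the computation, for `n` vertices and
weights with `L` digits. -/
def digitBound (n m L : ℕ) : ℕ :=
  7 + 6 * (n * n) + (n + 2 * L + 1) + (n + m) * (6 * (n * n)) ^ 2

/-- A bound for the cost of primitive operations, if adjacency tests cost at most `c`. -/
def opBound (n m L c : ℕ) : ℕ :=
  1 + n + 2 * digitBound n m L + (1 + digitBound n m L) * (1 + digitBound n m L) + c

theorem budget_opBound (n m L c : ℕ) : Budget n (digitBound n m L) (opBound n m L c) := by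
  constructor
  · have := size_le_self n
    unfold opBound; omega
  · unfold opBound; omega

theorem prod_den_le (w : Fin n → ℚ≥0) : ∏ u, (w u).den ≤ 2 ^ weightSize w := by
  calc ∏ u, (w u).den ≤ ∏ u, 2 ^ (w u).den.size :=
        Finset.prod_le_prod' fun u _ => (Nat.lt_size_self _).le
    _ = 2 ^ ∑ u, (w u).den.size := Finset.prod_pow_eq_pow_sum _ _ _
    _ ≤ _ := Nat.pow_le_pow_right (by norm_num)
        (Finset.sum_le_sum fun u _ => Nat.le_add_left _ _)

theorem num_size_le (w : Fin n → ℚ≥0) (v : Fin n) : (w v).num.size ≤ weightSize w :=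
  (Nat.le_add_right _ _).trans (Finset.single_le_sum
    (f := fun v => (w v).num.size + (w v).den.size) (fun _ _ => Nat.zero_le _) (Finset.mem_univ v))

/-- Numerators and the product of all denominators are each below `2 ^ weightSize w`, so the common
denominator keeps the digit counts linear in the input size. -/
theorem sum_clearedWeight_le (w : Fin n → ℚ≥0) :
    ∑ v, clearedWeight w v ≤ 2 ^ (n + 2 * weightSize w) := by
  have h : ∀ v ∈ Finset.univ, clearedWeight w v ≤ 2 ^ (2 * weightSize w) := fun v _ => by
    rw [two_mul, pow_add]
    exact Nat.mul_le_mul ((Nat.lt_size_self _).le.trans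
      (Nat.pow_le_pow_right (by norm_num) (num_size_le w v)))
      ((Nat.div_le_self _ _).trans (prod_den_le w))
  refine (Finset.sum_le_card_nsmul _ _ _ h).trans ?_
  rw [Finset.card_univ, Fintype.card_fin, smul_eq_mul, pow_add]
  exact Nat.mul_le_mul_right _ Nat.lt_two_pow_self.le

theorem fitsScaled_clearedWeight (w : Fin n → ℚ≥0) (m : ℕ) :
    FitsScaled n m (digitBound n m (weightSize w)) (clearedWeight w) := by
  have h1 := size_le_of_le_two_pow (sum_clearedWeight_le w)
  have h2 := size_le_self (6 * (n * n))
  have h3 := size_le_self ((n + m) * (6 * (n * n)) ^ 2)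
  have h4 := size_mul_le (6 * (n * n)) (∑ v, clearedWeight w v)
  constructor <;> unfold digitBound <;> omega

/-- The number of steps of the approximation algorithm. -/
def approxCost (n m L c : ℕ) : ℕ := opBound n m L c * (7 * n + approxIntCost n m)

theorem approx_runs (w : Fin n → ℚ≥0) (m c : ℕ) (hadj : Decides adj G c) :
    Runs (approx adj w m (roundBound n)) (approxCost n m (weightSize w) c) fun A =>
      G.IsIndepSet (toSet A : Set (Fin n)) ∧ ∀ v, BeatsCandidate G (clearedWeight w) m A v := by
  have hB := budget_opBound n m (weightSize w) c
  have hadj' : Decides adj G (opBound n m (weightSize w) c) := fun u v =>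
    (hadj u v).mono (Nat.le_add_left _ _) fun _ => id
  have h1 := size_le_of_le_two_pow (prod_den_le w)
  unfold approx
  refine .bind (T₂ := opBound n m (weightSize w) c * approxIntCost n m)
    (clearDenominators_runs hB w ?_ fun v => ?_) ?_ (le_of_eq (by unfold approxCost; ring))
  · unfold digitBound; omega
  · have := num_size_le w v
    unfold digitBound; omega
  · rintro _ rfl
    exact approxInt_runs hB hadj' _ m (fitsScaled_clearedWeight w m)

/-! ### Cost of adjacency tests -/

theorem adjMatrixQuery_runs (G : SimpleGraph (Fin n)) [DecidableRel G.Adj] :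
    Decides (adjMatrixQuery G) G (1 + 2 * n) := fun u v =>
  .bind (.tick (T := 1 + 2 * n) (by have := size_le_self n; omega))
    (fun _ _ => .pure (T := 0) (by simp)) le_rfl

theorem le_familyInputSize (F : Fin n → Finset ℕ) (w : Fin n → ℚ≥0) :
    n ≤ familyInputSize F w ∧ weightSize w ≤ familyInputSize F w ∧
      ∀ i, (F i).card ≤ familyInputSize F w ∧ ∀ x ∈ F i, x.size ≤ familyInputSize F w := by
  have h : ∀ i, ∑ x ∈ F i, (1 + x.size) ≤ familyInputSize F w := fun i => by
    have := Finset.single_le_sum (f := fun i => ∑ x ∈ F i, (1 + x.size))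
      (fun _ _ => Nat.zero_le _) (Finset.mem_univ i)
    unfold familyInputSize
    omega
  refine ⟨by unfold familyInputSize; omega, by unfold familyInputSize; omega, fun i => ⟨?_, ?_⟩⟩
  · have h1 := h i
    rw [Finset.sum_add_distrib, Finset.sum_const, smul_eq_mul, mul_one] at h1
    omega
  · intro x hx
    have h1 := Finset.single_le_sum (f := fun x : ℕ => 1 + x.size) (fun _ _ => Nat.zero_le _) hx
    have := h i
    omega

/-- A bound for the cost of an intersection test, for a family of size `N`. -/
def queryCost (N : ℕ) : ℕ := (1 + N) + ((1 + 2 * N) + N * (1 + N * (1 + N + N)))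

theorem conflictQuery_runs (F : Fin n → Finset ℕ) (w : Fin n → ℚ≥0) :
    Decides (conflictQuery F) (conflictGraph F) (queryCost (familyInputSize F w)) := by
  intro i j
  obtain ⟨hn, -, hF⟩ := le_familyInputSize F w
  set N := familyInputSize F w
  have hnN : n.size ≤ N := (size_le_self n).trans hn
  unfold conflictQuery
  have hsame : Runs (sameVertex i j) (1 + N) fun c => c = true ↔ i = j :=
    .bind (.tick (T := 1 + N) (by omega)) (fun _ _ => .pure (T := 0) (by simp)) le_rfl
  refine .bind hsame (fun b hb => .ite (fun h => .pure ?_) fun h =>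
    .bind (.tick (T := 1 + 2 * N) (by omega)) (fun _ _ => ?_) le_rfl) le_rfl
  · simp [conflictGraph, hb.1 h]
  · have hij : i ≠ j := fun h2 => by rw [hb.2 h2] at h; cases h
    refine (Runs.anyM (T := 1 + N * (1 + N + N)) (P := fun x => x ∈ F j) fun x hx => ?_).mono
      (Nat.mul_le_mul_right _ ?_) fun b hb => ?_
    · rw [Finset.mem_sort] at hx
      refine .bind (.tick le_rfl) (fun _ _ => (Runs.anyM (T := 1 + N + N) (P := fun y => x = y)
        fun y hy => ?_).mono (Nat.mul_le_mul_right _ ?_) fun b hb => ?_) le_rfl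
      · rw [Finset.mem_sort] at hy
        have h1 := (hF i).2 x hx
        have h2 := (hF j).2 y hy
        exact .bind (.tick (T := 1 + N + N) (by omega)) (fun _ _ => .pure (T := 0) (by simp)) le_rfl
      · rw [Finset.length_sort]; exact (hF j).1
      · rw [hb]; simp
    · rw [Finset.length_sort]; exact (hF i).1
    · rw [hb]
      simp [conflictGraph, hij, Finset.not_disjoint_iff]

end Program

/-! ## Polynomial bounds -/

/-- `f` is bounded by a polynomial in the size `sz` of the instance. -/
def PolyBounded {ι : Type*} (sz f : ι → ℕ) : Prop :=
  ∃ p : Polynomial ℕ, ∀ i, f i ≤ p.eval (sz i)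

namespace PolyBounded
variable {ι : Type*} {sz f g : ι → ℕ}

theorem of_le (h : ∀ i, f i ≤ sz i) : PolyBounded sz f := ⟨Polynomial.X, by simpa using h⟩

theorem const (c : ℕ) : PolyBounded sz fun _ => c := ⟨Polynomial.C c, by simp⟩

theorem add (hf : PolyBounded sz f) (hg : PolyBounded sz g) :
    PolyBounded sz fun i => f i + g i := by
  obtain ⟨p, hp⟩ := hf
  obtain ⟨q, hq⟩ := hg
  exact ⟨p + q, fun i => by rw [Polynomial.eval_add]; exact Nat.add_le_add (hp i) (hq i)⟩

theorem mul (hf : PolyBounded sz f) (hg : PolyBounded sz g) :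
    PolyBounded sz fun i => f i * g i := by
  obtain ⟨p, hp⟩ := hf
  obtain ⟨q, hq⟩ := hg
  exact ⟨p * q, fun i => by rw [Polynomial.eval_mul]; exact Nat.mul_le_mul (hp i) (hq i)⟩

theorem pow (hf : PolyBounded sz f) (e : ℕ) : PolyBounded sz fun i => f i ^ e := by
  obtain ⟨p, hp⟩ := hf
  exact ⟨p ^ e, fun i => by rw [Polynomial.eval_pow]; exact Nat.pow_le_pow_left (hp i) e⟩

/-- The exchange size `m` is a constant here; it occurs as the exponent of `n + 1` in the cost of
the enumeration. -/
theorem approxCost {n L c : ι → ℕ} (hn : PolyBounded sz n) (hL : PolyBounded sz L)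
    (hc : PolyBounded sz c) (m : ℕ) :
    PolyBounded sz fun i => SquaredWeight.approxCost (n i) m (L i) (c i) := by
  unfold SquaredWeight.approxCost opBound digitBound approxIntCost scaledCost greedyCost roundBound
    roundCost testCost
  repeat' first
    | exact hn | exact hL | exact hc | exact const _
    | apply add | apply mul | apply pow

theorem queryCost {N : ι → ℕ} (hN : PolyBounded sz N) :
    PolyBounded sz fun i => SquaredWeight.queryCost (N i) := by
  unfold SquaredWeight.queryCost
  repeat' first | exact hN | exact const _ | apply add | apply mul

end PolyBounded

theorem exists_polynomial_graph (m : ℕ) : ∃ p : Polynomial ℕ, ∀ (n : ℕ) (w : Fin n → ℚ≥0),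
    approxCost n m (weightSize w) (1 + 2 * n) ≤ p.eval (graphInputSize w) := by
  -- Instances of all dimensions form one index type, so that a single polynomial serves them all.
  let sz : (Σ n : ℕ, Fin n → ℚ≥0) → ℕ := fun i => graphInputSize i.2
  have hn : PolyBounded sz fun i => i.1 :=
    .of_le fun i => (Nat.le_mul_self i.1).trans (Nat.le_add_right _ _)
  obtain ⟨p, hp⟩ := PolyBounded.approxCost hn (.of_le fun i => Nat.le_add_left (weightSize i.2) _)
    ((PolyBounded.const 1).add ((PolyBounded.const 2).mul hn)) m
  exact ⟨p, fun n w => hp ⟨n, w⟩⟩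

theorem exists_polynomial_family (m : ℕ) :
    ∃ p : Polynomial ℕ, ∀ (n : ℕ) (F : Fin n → Finset ℕ) (w : Fin n → ℚ≥0),
    approxCost n m (weightSize w) (queryCost (familyInputSize F w)) ≤
      p.eval (familyInputSize F w) := by
  let sz : (Σ n : ℕ, (Fin n → Finset ℕ) × (Fin n → ℚ≥0)) → ℕ :=
    fun i => familyInputSize i.2.1 i.2.2
  obtain ⟨p, hp⟩ := PolyBounded.approxCost (sz := sz)
    (.of_le fun i => (le_familyInputSize i.2.1 i.2.2).1)
    (.of_le fun i => (le_familyInputSize i.2.1 i.2.2).2.1)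
    (PolyBounded.queryCost (.of_le fun i => le_rfl)) m
  exact ⟨p, fun n F w => hp ⟨n, F, w⟩⟩

/-- Common to both representations of the input, which differ only in the adjacency program and its
cost `c`. -/
theorem approx_spec {n : ℕ} {G : SimpleGraph (Fin n)} {adj : Fin n → Fin n → Timed Bool}
    {k s c : ℕ} {τ : ℝ} (hp : IsParam k s τ) (hk : 1 ≤ k) (hG : IsClawFree G (k + 1))
    (hadj : Decides adj G c) (w : Fin n → ℚ≥0) :
    ∃ (fuel : ℕ) (A : Fin n → Bool) (t : ℕ), (approx adj w (s * k) fuel).HaltsWith A t ∧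
      t ≤ approxCost n (s * k) (weightSize w) c ∧ G.IsIndepSet (toSet A : Set (Fin n)) ∧
      ∀ O : Finset (Fin n), G.IsIndepSet (O : Set (Fin n)) →
        ∑ v ∈ O, (w v : ℝ) ≤ (k + 1 - τ) / 2 * ∑ v ∈ toSet A, (w v : ℝ) := by
  obtain ⟨A, t, hA, ht, hAi, hbeats⟩ := approx_runs w (s * k) c hadj
  exact ⟨_, A, t, hA, ht, hAi, fun O hO => sum_le_of_clearedWeight w O _ _
    (ratio_of_beatsCandidate hp hk hG _ A hbeats O hO)⟩

end SquaredWeight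

theorem theorem1 :
    (∀ (k s : ℕ) (τ : ℝ), 1 ≤ k →
      ((s = k * (k - 1) + 1 ∧ τ = SquaredWeight.tauTwo k) ∨
        (s = 2 * k * (k - 1) + 1 ∧ τ = SquaredWeight.tauThree k)) →
      -- squared-weight local search on claw-free graphs with real weights
      (∀ (V : Type*) [Fintype V] [DecidableEq V] (G : SimpleGraph V) (w : V → ℝ),
        SquaredWeight.IsClawFree G (k + 1) → (∀ v, 0 ≤ w v) →
          WellFounded (fun T S => SquaredWeight.Improvement G w (s * k) S T) ∧
          (∃ A, SquaredWeight.IsLocalSearchOutput G w (s * k) A) ∧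
          ∀ A, SquaredWeight.IsLocalSearchOutput G w (s * k) A →
            G.IsIndepSet (A : Set V) ∧
            ∀ O : Finset V, G.IsIndepSet (O : Set V) →
              ∑ v ∈ O, w v ≤ (k + 1 - τ) / 2 * ∑ v ∈ A, w v) ∧
      -- squared-weight local search for set packing with real weights
      (∀ (ι U : Type*) [Fintype ι] [DecidableEq ι] (F : ι → Finset U) (w : ι → ℝ),
        (∀ i, (F i).card ≤ k) → (∀ i, 0 ≤ w i) →
          WellFounded (fun T S =>
            SquaredWeight.Improvement (SquaredWeight.conflictGraph F) w (s * k) S T) ∧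
          (∃ A, SquaredWeight.IsLocalSearchOutput (SquaredWeight.conflictGraph F) w (s * k) A) ∧
          ∀ A, SquaredWeight.IsLocalSearchOutput (SquaredWeight.conflictGraph F) w (s * k) A →
            SquaredWeight.IsPacking F A ∧
            ∀ O : Finset ι, SquaredWeight.IsPacking F O →
              ∑ i ∈ O, w i ≤ (k + 1 - τ) / 2 * ∑ i ∈ A, w i) ∧
      -- polynomial time, claw-free graphs
      (∃ p : Polynomial ℕ, ∀ (n : ℕ) (G : SimpleGraph (Fin n)) [DecidableRel G.Adj]
        (w : Fin n → ℚ≥0), SquaredWeight.IsClawFree G (k + 1) →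
          ∃ (fuel : ℕ) (A : Fin n → Bool) (t : ℕ),
            (SquaredWeight.approx (SquaredWeight.adjMatrixQuery G) w (s * k) fuel).HaltsWith A t ∧
            t ≤ p.eval (SquaredWeight.graphInputSize w) ∧
            G.IsIndepSet (SquaredWeight.toSet A : Set (Fin n)) ∧
            ∀ O : Finset (Fin n), G.IsIndepSet (O : Set (Fin n)) →
              ∑ v ∈ O, (w v : ℝ) ≤ (k + 1 - τ) / 2 * ∑ v ∈ SquaredWeight.toSet A, (w v : ℝ)) ∧
      -- polynomial time, set packing
      (∃ p : Polynomial ℕ, ∀ (n : ℕ) (F : Fin n → Finset ℕ) (w : Fin n → ℚ≥0),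
        (∀ i, (F i).card ≤ k) →
          ∃ (fuel : ℕ) (A : Fin n → Bool) (t : ℕ),
            (SquaredWeight.approx (SquaredWeight.conflictQuery F) w (s * k) fuel).HaltsWith A t ∧
            t ≤ p.eval (SquaredWeight.familyInputSize F w) ∧
            SquaredWeight.IsPacking F (SquaredWeight.toSet A) ∧
            ∀ O : Finset (Fin n), SquaredWeight.IsPacking F O →
              ∑ i ∈ O, (w i : ℝ) ≤ (k + 1 - τ) / 2 * ∑ i ∈ SquaredWeight.toSet A, (w i : ℝ))) ∧
    -- the constants are maxima, non-decreasing in `k`, with limits `1/2` and `2/3`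
    (∀ k : ℕ, 1 ≤ k →
      IsGreatest (SquaredWeight.gainTwo k '' Set.Icc 0 (1 / 2)) (SquaredWeight.tauTwo k) ∧
      IsGreatest (SquaredWeight.gainThree k '' Set.Icc 0 (1 / 2)) (SquaredWeight.tauThree k)) ∧
    Monotone SquaredWeight.tauTwo ∧
    Filter.Tendsto SquaredWeight.tauTwo Filter.atTop (nhds (1 / 2)) ∧
    Monotone SquaredWeight.tauThree ∧
    Filter.Tendsto SquaredWeight.tauThree Filter.atTop (nhds (2 / 3)) ∧
    -- the factors for `k = 3`, rounded up to three decimals, are `1.811` and `1.786`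
    (1.810 < (3 + 1 - SquaredWeight.tauTwo 3) / 2 ∧
      (3 + 1 - SquaredWeight.tauTwo 3) / 2 ≤ 1.811) ∧
    (1.785 < (3 + 1 - SquaredWeight.tauThree 3) / 2 ∧
      (3 + 1 - SquaredWeight.tauThree 3) / 2 ≤ 1.786) := by 
  refine ⟨fun k s τ hk hp => ?_, fun k _ => ⟨SquaredWeight.isGreatest_tauTwo k,
    SquaredWeight.isGreatest_tauThree k⟩, SquaredWeight.monotone_tauTwo,
    SquaredWeight.tendsto_tauTwo, SquaredWeight.monotone_tauThree,
    SquaredWeight.tendsto_tauThree, ?_, ?_⟩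
  · have hp : SquaredWeight.IsParam k s τ := hp
    refine ⟨?_, ?_, ?_, ?_⟩
    · intro V _ _ G w hG hw
      exact ⟨SquaredWeight.wellFounded_improvement G w _,
        SquaredWeight.exists_localSearchOutput G w _,
        fun A hA => ⟨hA.isIndepSet, fun O hO => hA.ratio hp hk hG hw hO⟩⟩
    · intro ι U _ _ F w hF hw
      have hG := SquaredWeight.isClawFree_conflictGraph F k hF
      refine ⟨SquaredWeight.wellFounded_improvement _ w _,
        SquaredWeight.exists_localSearchOutput _ w _, fun A hA => ?_⟩
      simp only [SquaredWeight.isPacking_iff]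
      exact ⟨hA.isIndepSet, fun O hO => hA.ratio hp hk hG hw hO⟩
    · obtain ⟨p, hpoly⟩ := SquaredWeight.exists_polynomial_graph (s * k)
      refine ⟨p, fun n G _ w hG => ?_⟩
      obtain ⟨fuel, A, t, hA, ht, h⟩ :=
        SquaredWeight.approx_spec hp hk hG (SquaredWeight.adjMatrixQuery_runs G) w
      exact ⟨fuel, A, t, hA, ht.trans (hpoly n w), h⟩
    · obtain ⟨p, hpoly⟩ := SquaredWeight.exists_polynomial_family (s * k)
      refine ⟨p, fun n F w hF => ?_⟩
      obtain ⟨fuel, A, t, hA, ht, h⟩ := SquaredWeight.approx_spec hp hk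
        (SquaredWeight.isClawFree_conflictGraph F k hF) (SquaredWeight.conflictQuery_runs F w) w
      simp only [SquaredWeight.isPacking_iff]
      exact ⟨fuel, A, t, hA, ht.trans (hpoly n F w), h⟩
  · have h := SquaredWeight.tauTwo_three_bounds
    constructor <;> norm_num at * <;> linarith
  · have h := SquaredWeight.tauThree_three_bounds
    constructor <;> norm_num at * <;> linarith
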